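/- Setting. Fix $d\ge 1$. For even $L$ let $\Lambda_L=\mathbb Z_L^d$ be the discrete torus, $\mathbb Z_L$ identified with $\{-L/2+1,\dots,L/2\}$, with its graph distance; let $|x_1-y_1|_L$ be the distance of $x_1,y_1$ in $\mathbb Z_L$. Put $\Gamma=\{0\le x_1<L/2\}$, $\partial_-=\{x_1=0\}$, $\partial_+=\{x_1=L/2-1\}$, $S_-=\{|x_1|_L\le L/8\}$, $S_+=\{|x_1-L/2|_L\le L/8\}$, and $X^r=\{x\in\Lambda_L:\mathrm{dist}(x,X)\le r\}$ for $X\subset\Lambda_L$. The system is either a spin system, with Hilbert space $\mathcal H_L=\bigotimes_{x\in\Lambda_L}\mathbb C^n$ and $\mathcal A_X$ the algebra of operators $O\otimes 1$ with $O$ acting on the sites of $X$; or a system of lattice fermions, with $\mathcal H_L$ the antisymmetric Fock space over $\ell^2(\Lambda_L,\mathbb C^n)$ and $\mathcal A_X$ the algebra generated by the even monomials in the creation and annihilation operators of the sites of $X$. Here $n$ does not depend on $L$. Put $\mathcal A_L=\mathcal A_{\Lambda_L}$. Identifying tori with boxes, $\mathcal A_L\subset\mathcal A_{L'}$ for $L\le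 L'$ by tensoring with the identity, and $\mathcal A_\infty$ is the norm completion of $\bigcup_L\mathcal A_L$. A sequence is $O(L^{-\infty})$ if it is $O(L^{-m})$ for every $m$. For a unit vector $\psi$, $\mathrm{Var}_\psi(A)=\|(A-\langle\psi,A\psi\rangle)\psi\|^2$. Assumptions. For every even $L$ let $Q_x=Q_x^*\in\mathcal A_{\{x\}}$ $(x\in\Lambda_L)$ have integer spectrum, put $Q=\sum_{x\in\Gamma}Q_x$, let $U=U_L\in\mathcal A_L$ be unitary, $\Omega=\Omega_L\in\mathcal H_L$ a unit vector and $T_\pm=T_{(\pm,L)}\in\mathcal A_{S_\pm}$ self-adjoint, such that, with all bounds and constants uniform in $L$: (i) there is $g$ with $g(m)=O(m^{-\infty})$ such that for all $L$, $X\subset\Lambda_L$, $A\in\mathcal A_X$ and $m\in\mathbb N$ there is $R\in\mathcal A_{X^m}$ with $\|U^*AU-R\|\le g(m)\,\|A\|\,|X|$; (ii) $\|U^*QU-Q-T_--T_+\|=O(L^{-\infty})$; (iii) $\mathrm{Var}_\Omega(U)=O(L^{-\infty})$; (iv) there are self-adjoint $K_\pm\in\mathcal A_{\partial_\pm^{L/16}}$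 with $\|K_\pm\|\le C|\Lambda_L|$ and $\mathrm{Var}_\Omega(Q-K_--K_+)=O(L^{-\infty})$; (v) there are $0<c,C<\infty$ such that for all $L$, $X,X'\subset\Lambda_L$, $A\in\mathcal A_X$, $B\in\mathcal A_{X'}$, $|\langle\Omega,AB\Omega\rangle-\langle\Omega,A\Omega\rangle\langle\Omega,B\Omega\rangle|\le C\|A\|\|B\||X||X'|e^{-c\,d_1(X,X')}$, where $d_1(X,X')=\min\{|x_1-x_1'|_L:x\in X,\,x'\in X'\}$; (vi) $\|e^{2\pi\mathrm i(Q+T_-)}-1\|=O(L^{-\infty})$ and $\|T_\pm\|\le C|\Lambda_L|$. Extend the states $\langle\Omega_L,(\cdot)\Omega_L\rangle$ on $\mathcal A_L$ to states $\omega_L$ on $\mathcal A_\infty$ (in any way). Statement. If the sequence $\omega_L$ is weak-$*$ convergent and the sequence $T_{(-,L)}$ converges in norm in $\mathcal A_\infty$, then the thermodynamic-limit index $$\mathrm{Ind}(U,\Omega):=\lim_{L\to\infty}\langle\Omega_L,T_{(-,L)}\Omega_L\rangle$$ exists and is an integer. -/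

import Mathlib

open Filter Topology
open scoped Matrix.Norms.L2Operator

namespace ManyBodyIndex

/-! ### Tensoring with the identity

For a finite set `V` of sites, each carrying a local basis `S`, the configurations `V → S` label
the product basis of the Hilbert space of `V`; operators are written as matrices in this basis. -/

/-- Configurations on the sites `V` with local basis `S`. -/
abbrev Conf (V S : Type*) : Type _ := V → S

/-- Operators on the Hilbert space with orthonormal basis `Conf V S`; the norm is the operator
norm of the Euclidean space. -/
abbrev Op (V S : Type*) : Type _ := Matrix (Conf V S) (Conf V S) ℂ

section Tensor

set_option linter.unusedSectionVars false

variable {V W Z S : Type*}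

/-- Two configurations on `W` agree away from the sites in the range of `e : V ↪ W`. -/
def AgreeOff (e : V ↪ W) (η ζ : Conf W S) : Prop := ∀ w, w ∉ Set.range e → η w = ζ w

open Classical in
/-- The matrix of `A ⊗ 1`, where `A` acts on the sites `V`, seen as sites of `W` through `e`, and
`1` is the identity on the other sites of `W`. -/
noncomputable def tensorOneFun (e : V ↪ W) (A : Op V S) : Op W S :=
  Matrix.of fun η ζ => if AgreeOff e η ζ then A (η ∘ e) (ζ ∘ e) else 0

open Classical in
/-- The configuration equal to `a` on the sites of `V` and to `η` elsewhere. -/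
noncomputable def glue (e : V ↪ W) (η : Conf W S) (a : Conf V S) : Conf W S :=
  fun w => if h : ∃ v, e v = w then a h.choose else η w

lemma glue_apply (e : V ↪ W) (η : Conf W S) (a : Conf V S) (v : V) : glue e η a (e v) = a v := by
  have h : ∃ v', e v' = e v := ⟨v, rfl⟩
  simp only [glue, dif_pos h]
  exact congrArg a (e.injective h.choose_spec)

lemma glue_comp (e : V ↪ W) (η : Conf W S) (a : Conf V S) : glue e η a ∘ e = a :=
  funext fun v => glue_apply e η a v

lemma glue_off (e : V ↪ W) (η : Conf W S) (a : Conf V S) {w : W} (hw : w ∉ Set.range e) :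
    glue e η a w = η w := dif_neg hw

lemma agreeOff_glue (e : V ↪ W) (η : Conf W S) (a : Conf V S) : AgreeOff e η (glue e η a) :=
  fun _ hw => (glue_off e η a hw).symm

lemma AgreeOff.eq_glue {e : V ↪ W} {η ζ : Conf W S} (h : AgreeOff e η ζ) :
    glue e η (ζ ∘ e) = ζ := by
  funext w
  by_cases hw : w ∈ Set.range e
  · obtain ⟨v, rfl⟩ := hw
    exact glue_apply ..
  · rw [glue_off e _ _ hw, h w hw]

lemma AgreeOff.eq_iff {e : V ↪ W} {η ζ : Conf W S} (h : AgreeOff e η ζ) :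
    η ∘ e = ζ ∘ e ↔ η = ζ := by
  refine ⟨fun h' => ?_, fun h' => by rw [h']⟩
  rw [← h.eq_glue, ← h', AgreeOff.eq_glue (fun _ _ => rfl)]

variable [Fintype V] [Fintype W] [Fintype S] [DecidableEq V] [DecidableEq W] [DecidableEq S]

lemma tensorOneFun_one (e : V ↪ W) : tensorOneFun e (1 : Op V S) = 1 := by
  ext η ζ
  by_cases h : AgreeOff e η ζ
  · simp [tensorOneFun, h, Matrix.one_apply, h.eq_iff]
  · have : η ≠ ζ := by rintro rfl; exact h fun _ _ => rfl
    simp [tensorOneFun, h, this]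

lemma tensorOneFun_mul (e : V ↪ W) (A B : Op V S) :
    tensorOneFun e (A * B) = tensorOneFun e A * tensorOneFun e B := by
  ext η ζ
  by_cases h : AgreeOff e η ζ
  · simp only [tensorOneFun, Matrix.of_apply, if_pos h, Matrix.mul_apply]
    refine Finset.sum_of_injOn (glue e η) ?_ (by simp) ?_ ?_
    · intro a _ b _ hab
      rw [← glue_comp e η a, ← glue_comp e η b, hab]
    · intro ξ _ hξ
      have : ¬ AgreeOff e η ξ := fun h' => hξ ⟨ξ ∘ e, by simp, h'.eq_glue⟩
      simp [this]
    · intro a _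
      have h2 : AgreeOff e (glue e η a) ζ := fun w hw => by rw [glue_off e _ _ hw, h w hw]
      simp [agreeOff_glue, h2, glue_comp]
  · simp only [tensorOneFun, Matrix.of_apply, if_neg h, Matrix.mul_apply]
    refine (Finset.sum_eq_zero fun ξ _ => ?_).symm
    by_cases h1 : AgreeOff e η ξ
    · have h2 : ¬ AgreeOff e ξ ζ := fun h2 => h fun w hw => (h1 w hw).trans (h2 w hw)
      simp [h2]
    · simp [h1]

lemma tensorOneFun_smul_one (e : V ↪ W) (r : ℂ) :
    tensorOneFun e (r • (1 : Op V S)) = r • 1 := by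
  rw [← tensorOneFun_one e]
  ext η ζ
  by_cases h : AgreeOff e η ζ <;> simp [tensorOneFun, h]

/-- `A ↦ A ⊗ 1` as a homomorphism of unital `*`-algebras. -/
noncomputable def tensorOne (e : V ↪ W) : Op V S →⋆ₐ[ℂ] Op W S where
  toFun := tensorOneFun e
  map_one' := tensorOneFun_one e
  map_mul' := tensorOneFun_mul e
  map_zero' := by ext η ζ; simp [tensorOneFun]
  map_add' A B := by
    ext η ζ
    by_cases h : AgreeOff e η ζ <;> simp [tensorOneFun, h]
  commutes' r := by
    rw [Algebra.algebraMap_eq_smul_one, Algebra.algebraMap_eq_smul_one]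
    exact tensorOneFun_smul_one e r
  map_star' A := by
    ext η ζ
    by_cases h : AgreeOff e η ζ
    · have h' : AgreeOff e ζ η := fun w hw => (h w hw).symm
      simp [tensorOneFun, h, h', Matrix.star_apply]
    · have h' : ¬ AgreeOff e ζ η := fun h' => h fun w hw => (h' w hw).symm
      simp [tensorOneFun, h, h', Matrix.star_apply]

lemma tensorOne_injective [Nonempty S] (e : V ↪ W) :
    Function.Injective (tensorOne e : Op V S → Op W S) := by
  intro A B hAB
  obtain ⟨s⟩ := ‹Nonempty S›
  ext a b
  have h := congrFun (congrFun hAB (glue e (fun _ => s) a)) (glue e (fun _ => s) b)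
  have h' : AgreeOff e (glue e (fun _ => s) a) (glue e (fun _ => s) b) :=
    fun w hw => by rw [glue_off e _ _ hw, glue_off e _ _ hw]
  simpa [tensorOne, tensorOneFun, h', glue_comp] using h

lemma tensorOne_id (e : V ↪ V) (he : ∀ v, e v = v) (A : Op V S) : tensorOne e A = A := by
  have he' : (e : V → V) = id := funext he
  ext η ζ
  have h : AgreeOff e η ζ := fun w hw => absurd ⟨w, he w⟩ hw
  simp [tensorOne, tensorOneFun, h, he']

lemma tensorOne_surjective (e : V ↪ W) (he : Function.Surjective e) :
    Function.Surjective (tensorOne e : Op V S → Op W S) := by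
  intro A
  have h : ∀ η ζ : Conf W S, AgreeOff e η ζ := fun η ζ w hw => absurd (he w) hw
  have h2 : ∀ η : Conf W S, glue e η (η ∘ e) = η := fun η => (h η η).eq_glue
  refine ⟨Matrix.of fun a b => A (a ∘ Function.surjInv he) (b ∘ Function.surjInv he), ?_⟩
  ext η ζ
  have h3 : ∀ η : Conf W S, (η ∘ e) ∘ Function.surjInv he = η :=
    fun η => funext fun w => congrArg η (Function.surjInv_eq he w)
  simp [tensorOne, tensorOneFun, h η ζ, h3]

lemma tensorOne_tensorOne [Fintype Z] [DecidableEq Z] (e : V ↪ W) (f : W ↪ Z) (g : V ↪ Z)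
    (hg : ∀ v, f (e v) = g v) (A : Op V S) : tensorOne f (tensorOne e A) = tensorOne g A := by
  ext η ζ
  have h1 : ∀ η : Conf Z S, (η ∘ f) ∘ e = η ∘ g := fun η => funext fun v => congrArg η (hg v)
  by_cases h : AgreeOff g η ζ
  · have h2 : AgreeOff f η ζ := fun w hw => h w fun ⟨v, hv⟩ => hw ⟨e v, by rw [hg, hv]⟩
    have h3 : AgreeOff e (η ∘ f) (ζ ∘ f) := fun w hw => h (f w) fun ⟨v, hv⟩ =>
      hw ⟨v, f.injective (by rw [hg, hv])⟩
    simp [tensorOne, tensorOneFun, h, h2, h3, h1]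
  · by_cases h2 : AgreeOff f η ζ
    · have h3 : ¬ AgreeOff e (η ∘ f) (ζ ∘ f) := by
        intro h3
        refine h fun z hz => ?_
        by_cases hz' : z ∈ Set.range f
        · obtain ⟨w, rfl⟩ := hz'
          exact h3 w fun ⟨v, hv⟩ => hz ⟨v, by rw [← hg, hv]⟩
        · exact h2 z hz'
      simp [tensorOne, tensorOneFun, h, h2, h3]
    · simp [tensorOne, tensorOneFun, h, h2]

end Tensor

/-! ### The torus -/

/-- `ℤ / L ℤ` with `L = 2 * ℓ`, identified with `{-L/2 + 1, …, L/2}`. -/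
abbrev Cyc (ℓ : ℕ) : Type := ↥(Finset.Ioc (-(ℓ : ℤ)) (ℓ : ℤ))

/-- The discrete `d`-dimensional torus with `L ^ d` sites, `L = 2 * ℓ`. -/
abbrev Torus (d ℓ : ℕ) : Type := Fin d → Cyc ℓ

/-- Distance of two integers modulo `2 * ℓ` (for integers in `{-ℓ + 1, …, ℓ}`). -/
def cycDist (ℓ : ℕ) (a b : ℤ) : ℕ := min (a - b).natAbs (2 * ℓ - (a - b).natAbs)

/-- Graph distance on the torus. -/
def torusDist {d ℓ : ℕ} (x y : Torus d ℓ) : ℕ := ∑ i, cycDist ℓ (x i) (y i)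

/-- The fattening `X ^ r` of a region `X`: the sites at graph distance at most `r` from `X`. -/
noncomputable def fatten {d ℓ : ℕ} (X : Finset (Torus d ℓ)) (r : ℝ) : Finset (Torus d ℓ) :=
  open Classical in {x | ∃ y ∈ X, (torusDist x y : ℝ) ≤ r}

section Regions

variable (d ℓ : ℕ) [NeZero d]

/-- The half torus `{0 ≤ x₁ < L/2}`. -/
noncomputable def halfTorus : Finset (Torus d ℓ) := {x | 0 ≤ (x 0 : ℤ) ∧ (x 0 : ℤ) < ℓ}

/-- The boundary `{x₁ = 0}` of the half torus. -/
noncomputable def bdryMinus : Finset (Torus d ℓ) := {x | (x 0 : ℤ) = 0}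

/-- The boundary `{x₁ = L/2 - 1}` of the half torus. -/
noncomputable def bdryPlus : Finset (Torus d ℓ) := {x | (x 0 : ℤ) = (ℓ : ℤ) - 1}

/-- The strip `{-L/8 ≤ x₁ ≤ L/8}`. -/
noncomputable def stripMinus : Finset (Torus d ℓ) := {x | 8 * cycDist ℓ (x 0) 0 ≤ 2 * ℓ}

/-- The strip `{-L/8 ≤ x₁ - L/2 ≤ L/8}`, where `x₁ - L/2` is taken modulo `L`. -/
noncomputable def stripPlus : Finset (Torus d ℓ) := {x | 8 * cycDist ℓ (x 0) ℓ ≤ 2 * ℓ}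

variable {d ℓ}

/-- The distance `d₁(X, X')` of two regions in the `x₁`-direction of the torus. -/
noncomputable def dist₁ (X X' : Finset (Torus d ℓ)) : ℕ :=
  sInf {k | ∃ x ∈ X, ∃ x' ∈ X', k = cycDist ℓ (x 0) (x' 0)}

end Regions

/-- The torus of size `2 * ℓ`, identified with a box, is part of the torus of size `2 * ℓ'`. -/
def torusEmb (d : ℕ) {ℓ ℓ' : ℕ} (h : ℓ ≤ ℓ') : Torus d ℓ ↪ Torus d ℓ' where
  toFun x i := ⟨x i, by have := (x i).2; simp only [Finset.mem_Ioc] at this ⊢; omega⟩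
  inj' x y hxy := by
    funext i
    have := congrArg Subtype.val (congrFun hxy i)
    exact Subtype.ext this

/-! ### Fermions

Antisymmetric Fock space over `ℓ²(Λ, ℂⁿ)` in the occupation number representation: the local basis
`Fin n → Bool` records which of the modes `(x, σ)`, `σ : Fin n`, are occupied. The signs depend on
a choice of a linear order of the modes. In the order chosen here the sites of any box come before
those outside it, so that the embedding `c_{x,σ} ↦ c_{x,σ}` of the algebra of a box into that of a
larger box is `A ↦ A ⊗ 1`. -/

/-- The least `ℓ` such that all coordinates of `z` lie in `{-ℓ + 1, …, ℓ}`. -/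
def shell {d : ℕ} (z : Fin d → ℤ) : ℕ := Finset.univ.sup fun i => (max (z i) (1 - z i)).toNat

/-- Coordinates of a site. -/
def coords {d ℓ : ℕ} (x : Torus d ℓ) : Fin d → ℤ := fun i => x i

/-- Modes are ordered by shell, then lexicographically. -/
def modeKey {d ℓ n : ℕ} (x : Torus d ℓ) (σ : Fin n) : ℕ ×ₗ Lex (Fin d → ℤ) ×ₗ Fin n :=
  toLex (shell (coords x), toLex (toLex (coords x), σ))

open Classical in
/-- Number of occupied modes that precede the mode `(x, σ)` in the configuration `ζ`. -/
noncomputable def occBefore {d ℓ n : ℕ} (x : Torus d ℓ) (σ : Fin n)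
    (ζ : Conf (Torus d ℓ) (Fin n → Bool)) : ℕ :=
  Finset.card {p : Torus d ℓ × Fin n | modeKey p.1 p.2 < modeKey x σ ∧ ζ p.1 p.2 = true}

open Classical in
/-- The annihilation operator `c_{x,σ}`; its adjoint is the creation operator. -/
noncomputable def annihilate {d ℓ n : ℕ} (x : Torus d ℓ) (σ : Fin n) :
    Op (Torus d ℓ) (Fin n → Bool) :=
  Matrix.of fun η ζ =>
    if ζ x σ = true ∧ η = Function.update ζ x (Function.update (ζ x) σ false)
    then (-1) ^ occBefore x σ ζ else 0

/-- The creation and annihilation operators of the modes in a region. -/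
def fermiGenerators {d ℓ : ℕ} (n : ℕ) (X : Finset (Torus d ℓ)) :
    Set (Op (Torus d ℓ) (Fin n → Bool)) :=
  {A | ∃ x ∈ X, ∃ σ : Fin n, A = annihilate x σ ∨ A = star (annihilate x σ)}

/-- The even algebra of a region, generated by the monomials in an even number of creation and
annihilation operators (equivalently by those in two of them). -/
noncomputable def evenAlgebra {d ℓ : ℕ} (n : ℕ) (X : Finset (Torus d ℓ)) :
    StarSubalgebra ℂ (Op (Torus d ℓ) (Fin n → Bool)) :=
  StarAlgebra.adjoin ℂ
    {A | ∃ a ∈ fermiGenerators n X, ∃ b ∈ fermiGenerators n X, A = a * b}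

lemma shell_coords_le {d ℓ : ℕ} (x : Torus d ℓ) : shell (coords x) ≤ ℓ := by
  refine Finset.sup_le fun i _ => ?_
  have := (x i).2
  simp only [Finset.mem_Ioc] at this
  simp only [coords]
  omega

lemma mem_range_torusEmb {d ℓ ℓ' : ℕ} (h : ℓ ≤ ℓ') (y : Torus d ℓ') (hy : shell (coords y) ≤ ℓ) :
    y ∈ Set.range (torusEmb d h) := by
  refine ⟨fun i => ⟨y i, ?_⟩, rfl⟩
  have h1 : (max (coords y i) (1 - coords y i)).toNat ≤ ℓ :=
    (Finset.le_sup (f := fun i => (max (coords y i) (1 - coords y i)).toNat)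
      (Finset.mem_univ i)).trans hy
  simp only [coords] at h1
  simp only [Finset.mem_Ioc]
  omega

lemma modeKey_torusEmb {d ℓ ℓ' n : ℕ} (h : ℓ ≤ ℓ') (x : Torus d ℓ) (σ : Fin n) :
    modeKey (torusEmb d h x) σ = modeKey x σ := rfl

lemma occBefore_torusEmb {d ℓ ℓ' n : ℕ} (h : ℓ ≤ ℓ') (x : Torus d ℓ) (σ : Fin n)
    (ζ : Conf (Torus d ℓ') (Fin n → Bool)) :
    occBefore (torusEmb d h x) σ ζ = occBefore x σ (ζ ∘ torusEmb d h) := by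
  classical
  symm
  refine Finset.card_bij (fun p _ => (torusEmb d h p.1, p.2)) ?_ ?_ ?_
  · intro p hp
    rw [Finset.mem_filter] at hp ⊢
    exact ⟨Finset.mem_univ _, hp.2⟩
  · intro p _ q _ hpq
    simp only [Prod.mk.injEq, EmbeddingLike.apply_eq_iff_eq] at hpq
    exact Prod.ext hpq.1 hpq.2
  · rintro ⟨y, τ⟩ hy
    simp only [Finset.mem_filter, Finset.mem_univ, true_and] at hy
    have h1 : shell (coords y) ≤ shell (coords (torusEmb d h x)) := by
      have := hy.1
      simp only [modeKey, Prod.Lex.toLex_lt_toLex] at this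
      rcases this with h2 | h2
      · exact h2.le
      · exact h2.1.le
    obtain ⟨y', rfl⟩ := mem_range_torusEmb h y (h1.trans (shell_coords_le x))
    exact ⟨(y', τ), by simpa [modeKey_torusEmb] using hy, rfl⟩

lemma tensorOne_annihilate {d ℓ ℓ' n : ℕ} (h : ℓ ≤ ℓ') (x : Torus d ℓ) (σ : Fin n) :
    tensorOne (torusEmb d h) (annihilate x σ) = annihilate (torusEmb d h x) σ := by
  classical
  ext η ζ
  set e := torusEmb d h with he
  have key : ∀ b : Fin n → Bool, (AgreeOff e η ζ ∧ η ∘ e = Function.update (ζ ∘ e) x b) ↔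
      η = Function.update ζ (e x) b := by
    intro b
    constructor
    · rintro ⟨h1, h2⟩
      funext y
      by_cases hy : y ∈ Set.range e
      · obtain ⟨y, rfl⟩ := hy
        have h3 := congrFun h2 y
        simpa [Function.update_apply] using h3
      · have h3 : y ≠ e x := by rintro rfl; exact hy ⟨x, rfl⟩
        rw [h1 y hy, Function.update_of_ne h3]
    · rintro rfl
      refine ⟨fun y hy => ?_, ?_⟩
      · have h3 : y ≠ e x := by rintro rfl; exact hy ⟨x, rfl⟩
        rw [Function.update_of_ne h3]
      · funext y
        simp [Function.update_apply]
  have h0 := key (Function.update (ζ (e x)) σ false)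
  change (if AgreeOff e η ζ then (annihilate x σ) (η ∘ e) (ζ ∘ e) else 0) = _
  have h1 : occBefore (e x) σ ζ = occBefore x σ (ζ ∘ e) := occBefore_torusEmb h x σ ζ
  simp only [annihilate, Matrix.of_apply, h1, Function.comp_apply, ← h0]
  by_cases h1 : AgreeOff e η ζ <;> simp [h1]

lemma tensorOne_mem_evenAlgebra {d ℓ ℓ' : ℕ} (n : ℕ) (h : ℓ ≤ ℓ')
    {A : Op (Torus d ℓ) (Fin n → Bool)} (hA : A ∈ evenAlgebra n Finset.univ) :
    tensorOne (torusEmb d h) A ∈ evenAlgebra n Finset.univ := by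
  have h1 : tensorOne (torusEmb d h) A ∈
      (evenAlgebra n (Finset.univ : Finset (Torus d ℓ))).map (tensorOne (torusEmb d h)) :=
    ⟨A, hA, rfl⟩
  have h2 : ∀ a ∈ fermiGenerators n (Finset.univ : Finset (Torus d ℓ)),
      tensorOne (torusEmb d h) a ∈ fermiGenerators n (Finset.univ : Finset (Torus d ℓ')) := by
    rintro a ⟨x, -, σ, rfl | rfl⟩
    · exact ⟨_, Finset.mem_univ _, σ, Or.inl (tensorOne_annihilate h x σ)⟩
    · exact ⟨_, Finset.mem_univ _, σ, Or.inr (by rw [map_star, tensorOne_annihilate])⟩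
  rw [evenAlgebra, StarAlgHom.map_adjoin] at h1
  refine StarAlgebra.adjoin_mono ?_ h1
  rintro _ ⟨_, ⟨a, ha, b, hb, rfl⟩, rfl⟩
  exact ⟨_, h2 a ha, _, h2 b hb, map_mul _ _ _⟩

/-! ### Spin systems and fermionic systems -/

/-- The systems considered: spins with local space `ℂⁿ`, `n ≥ 1`, and lattice fermions with `n`
modes per site. -/
inductive Kind : Type
  | spin (n : ℕ+)
  | fermion (n : ℕ)

/-- The local basis at a site. -/
abbrev Kind.Loc : Kind → Type
  | .spin n => Fin n
  | .fermion n => Fin n → Bool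

instance (k : Kind) : Fintype k.Loc :=
  match k with
  | .spin n => inferInstanceAs (Fintype (Fin n))
  | .fermion n => inferInstanceAs (Fintype (Fin n → Bool))

instance (k : Kind) : DecidableEq k.Loc :=
  match k with
  | .spin n => inferInstanceAs (DecidableEq (Fin n))
  | .fermion n => inferInstanceAs (DecidableEq (Fin n → Bool))

instance (k : Kind) : Nonempty k.Loc :=
  match k with
  | .spin n => ⟨(⟨0, n.pos⟩ : Fin n)⟩
  | .fermion n => inferInstanceAs (Nonempty (Fin n → Bool))

/-- The Hilbert space of the torus of size `L = 2 * ℓ`. -/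
abbrev Hilb (k : Kind) (d ℓ : ℕ) : Type := EuclideanSpace ℂ (Conf (Torus d ℓ) k.Loc)

/-- All operators on the Hilbert space of the torus of size `L = 2 * ℓ`. -/
abbrev FullOp (k : Kind) (d ℓ : ℕ) : Type := Op (Torus d ℓ) k.Loc

/-- The algebra `𝒜_X` of the observables supported in the region `X`: for spins the operators
`O ⊗ 1` with `O` acting on the sites of `X`, for fermions the even algebra of `X`. -/
noncomputable def localAlg (k : Kind) {d ℓ : ℕ} (X : Finset (Torus d ℓ)) :
    StarSubalgebra ℂ (FullOp k d ℓ) :=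
  match k with
  | .spin n => (tensorOne (S := Fin n) (Function.Embedding.subtype (· ∈ X))).range
  | .fermion n => evenAlgebra n X

/-- The algebra `𝒜_L` of all observables of the torus of size `L = 2 * ℓ`. -/
abbrev Obs (k : Kind) (d ℓ : ℕ) : Type := ↥(localAlg k (Finset.univ : Finset (Torus d ℓ)))

lemma tensorOne_mem_localAlg (k : Kind) {d ℓ ℓ' : ℕ} (h : ℓ ≤ ℓ') {A : FullOp k d ℓ}
    (hA : A ∈ localAlg k Finset.univ) :
    (tensorOne (torusEmb d h) A : FullOp k d ℓ') ∈ localAlg k Finset.univ := by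
  match k with
  | .spin n =>
    obtain ⟨B, hB⟩ := tensorOne_surjective (S := Fin n)
      (Function.Embedding.subtype (· ∈ (Finset.univ : Finset (Torus d ℓ'))))
      (fun x => ⟨⟨x, Finset.mem_univ x⟩, rfl⟩) (tensorOne (torusEmb d h) A)
    exact ⟨B, hB⟩
  | .fermion n => exact tensorOne_mem_evenAlgebra n h hA

/-- The embedding `𝒜_L → 𝒜_{L'}`, `L ≤ L'`, by tensoring with the identity. -/
noncomputable def obsEmb (k : Kind) (d : ℕ) {ℓ ℓ' : ℕ} (h : ℓ ≤ ℓ') :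
    Obs k d ℓ →⋆ₐ[ℂ] Obs k d ℓ' :=
  ((tensorOne (torusEmb d h)).comp (StarSubalgebra.subtype _)).codRestrict _
    fun A => tensorOne_mem_localAlg k h A.2

lemma coe_obsEmb (k : Kind) (d : ℕ) {ℓ ℓ' : ℕ} (h : ℓ ≤ ℓ') (A : Obs k d ℓ) :
    (obsEmb k d h A : FullOp k d ℓ') = tensorOne (torusEmb d h) (A : FullOp k d ℓ) := rfl

lemma norm_obsEmb (k : Kind) (d : ℕ) {ℓ ℓ' : ℕ} (h : ℓ ≤ ℓ') (A : Obs k d ℓ) :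
    ‖obsEmb k d h A‖ = ‖A‖ :=
  NonUnitalStarAlgHom.norm_map (tensorOne (torusEmb d h) : FullOp k d ℓ →⋆ₐ[ℂ] FullOp k d ℓ')
    (tensorOne_injective _) (A : FullOp k d ℓ)

instance (k : Kind) (d : ℕ) :
    DirectedSystem (Obs k d) (fun _ _ h => (obsEmb k d h : _ → _)) where
  map_self _ _ := Subtype.ext (tensorOne_id _ (fun _ => rfl) _)
  map_map _ _ _ _ _ _ := Subtype.ext (tensorOne_tensorOne _ _ _ (fun _ => rfl) _)

/-! ### The quasi-local algebra -/

/-- The algebra `⋃_L 𝒜_L` of local observables, as the direct limit of the algebras `𝒜_L`. -/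
def LocObs (k : Kind) (d : ℕ) : Type := DirectLimit (Obs k d) (fun _ _ h => obsEmb k d h)

namespace LocObs

variable (k : Kind) (d : ℕ)

noncomputable instance : Ring (LocObs k d) :=
  inferInstanceAs (Ring (DirectLimit (Obs k d) (fun _ _ h => obsEmb k d h)))

noncomputable instance : Algebra ℂ (LocObs k d) :=
  inferInstanceAs (Algebra ℂ (DirectLimit (Obs k d) (fun _ _ h => obsEmb k d h)))

noncomputable instance : StarAddMonoid (LocObs k d) :=
  inferInstanceAs (StarAddMonoid (DirectLimit (Obs k d) (fun _ _ h => obsEmb k d h)))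

variable {k d}

/-- The inclusion of `𝒜_L` in the algebra of local observables. -/
noncomputable def of {ℓ : ℕ} (A : Obs k d ℓ) : LocObs k d :=
  (⟦⟨ℓ, A⟩⟧ : DirectLimit (Obs k d) (fun _ _ h => obsEmb k d h))

lemma of_obsEmb {ℓ ℓ' : ℕ} (h : ℓ ≤ ℓ') (A : Obs k d ℓ) : of (obsEmb k d h A) = of A :=
  DirectLimit.mk_apply (f := fun _ _ h => obsEmb k d h) ℓ ℓ' A h

lemma exists_of (x : LocObs k d) : ∃ (ℓ : ℕ) (A : Obs k d ℓ), x = of A :=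
  DirectLimit.exists_eq_mk (fun _ _ h => obsEmb k d h) x

lemma exists_of₂ (x y : LocObs k d) : ∃ (ℓ : ℕ) (A B : Obs k d ℓ), x = of A ∧ y = of B :=
  DirectLimit.exists_eq_mk₂ (fun _ _ h => obsEmb k d h) x y

lemma of_add {ℓ : ℕ} (A B : Obs k d ℓ) : of A + of B = of (A + B) :=
  DirectLimit.add_def (f := fun _ _ h => obsEmb k d h) ℓ A B

lemma of_mul {ℓ : ℕ} (A B : Obs k d ℓ) : of A * of B = of (A * B) :=
  DirectLimit.mul_def (f := fun _ _ h => obsEmb k d h) ℓ A B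

lemma of_smul {ℓ : ℕ} (c : ℂ) (A : Obs k d ℓ) : c • of A = of (c • A) := rfl

lemma of_star {ℓ : ℕ} (A : Obs k d ℓ) : star (of A) = of (star A) := rfl

lemma of_zero (ℓ : ℕ) : of (0 : Obs k d ℓ) = 0 :=
  (DirectLimit.zero_def (f := fun _ _ h => obsEmb k d h) ℓ).symm

lemma of_one (ℓ : ℕ) : of (1 : Obs k d ℓ) = 1 :=
  (DirectLimit.one_def (f := fun _ _ h => obsEmb k d h) ℓ).symm

/-- The norm for which all inclusions of the algebras `𝒜_L` are isometric. -/
noncomputable instance : Norm (LocObs k d) where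
  norm := DirectLimit.lift (fun _ _ h => obsEmb k d h) (fun _ A => ‖A‖)
    fun _ _ h A => (norm_obsEmb k d h A).symm

lemma norm_of {ℓ : ℕ} (A : Obs k d ℓ) : ‖of A‖ = ‖A‖ := rfl

lemma normCore : NormedSpace.Core ℂ (LocObs k d) where
  norm_nonneg x := by
    obtain ⟨ℓ, A, rfl⟩ := exists_of x
    exact norm_nonneg A
  norm_smul c x := by
    obtain ⟨ℓ, A, rfl⟩ := exists_of x
    exact norm_smul c A
  norm_triangle x y := by
    obtain ⟨ℓ, A, B, rfl, rfl⟩ := exists_of₂ x y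
    rw [of_add]
    exact norm_add_le A B
  norm_eq_zero_iff x := by
    obtain ⟨ℓ, A, rfl⟩ := exists_of x
    refine ⟨fun h => ?_, fun h => ?_⟩
    · rw [norm_eq_zero.mp (show ‖A‖ = 0 from h), of_zero]
    · rw [h, ← of_zero ℓ, norm_of, norm_zero]

noncomputable instance : NormedRing (LocObs k d) :=
  { (inferInstance : Ring (LocObs k d)),
    NormedAddCommGroup.ofCore (normCore (k := k) (d := d)) with
    norm_mul_le := fun x y => by
      obtain ⟨ℓ, A, B, rfl, rfl⟩ := exists_of₂ x y
      rw [of_mul]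
      exact norm_mul_le A B }

noncomputable instance : NormedAlgebra ℂ (LocObs k d) :=
  { (inferInstance : Algebra ℂ (LocObs k d)) with
    norm_smul_le := fun c x => (normCore.norm_smul c x).le }

lemma norm_star_eq (x : LocObs k d) : ‖star x‖ = ‖x‖ := by
  obtain ⟨ℓ, A, rfl⟩ := exists_of x
  exact norm_star (A : FullOp k d ℓ)

end LocObs

/-- The quasi-local algebra `𝒜_∞`, the norm completion of `⋃_L 𝒜_L`. -/
abbrev QuasiLocal (k : Kind) (d : ℕ) : Type := UniformSpace.Completion (LocObs k d)

/-- The adjoint on the quasi-local algebra, extended from the local observables by continuity. -/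
noncomputable instance (k : Kind) (d : ℕ) : Star (QuasiLocal k d) where
  star := UniformSpace.Completion.map star

lemma QuasiLocal.star_coe {k : Kind} {d : ℕ} (x : LocObs k d) :
    star (x : QuasiLocal k d) = ((star x : LocObs k d) : QuasiLocal k d) := by
  refine UniformSpace.Completion.map_coe (Isometry.uniformContinuous ?_) x
  refine Isometry.of_dist_eq fun x y => ?_
  rw [dist_eq_norm, dist_eq_norm, ← star_sub, LocObs.norm_star_eq]

/-- The inclusion `𝒜_L → 𝒜_∞`. -/
noncomputable def toQuasiLocal {k : Kind} {d ℓ : ℕ} (A : Obs k d ℓ) : QuasiLocal k d :=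
  (LocObs.of A : LocObs k d)

/-- States on the quasi-local algebra: normalized positive continuous linear functionals. The
topology of the dual is the weak-* topology. -/
def IsState {k : Kind} {d : ℕ} (ω : WeakDual ℂ (QuasiLocal k d)) : Prop :=
  ω 1 = 1 ∧ ∀ a : QuasiLocal k d, ∃ r : ℝ, 0 ≤ r ∧ ω (star a * a) = r

/-! ### Vectors, expectations, variances -/

section Expectation

variable {k : Kind} {d ℓ : ℕ}

/-- The action of an operator on a vector. -/
noncomputable def act (A : FullOp k d ℓ) (ψ : Hilb k d ℓ) : Hilb k d ℓ :=
  Matrix.toEuclideanCLM (𝕜 := ℂ) A ψ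

/-- The expectation `⟨ψ, A ψ⟩`. -/
noncomputable def expect (ψ : Hilb k d ℓ) (A : FullOp k d ℓ) : ℂ := inner ℂ ψ (act A ψ)

/-- The variance `‖(A - ⟨ψ, A ψ⟩) ψ‖ ^ 2`. -/
noncomputable def variance (ψ : Hilb k d ℓ) (A : FullOp k d ℓ) : ℝ :=
  ‖act A ψ - expect ψ A • ψ‖ ^ 2

end Expectation

/-! ### The assumptions

Everything is a sequence indexed by `ℓ`, the size of the torus being `L = 2 * ℓ`. -/

/-- `f N = O(N ^ (-∞))`. Since `L = 2 * ℓ`, the bounds `O(L ^ (-∞))` and `O(ℓ ^ (-∞))` are the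
same. -/
def RapidDecay (f : ℕ → ℝ) : Prop := ∀ m : ℕ, f =O[atTop] fun N : ℕ => ((N : ℝ) ^ m)⁻¹

section Assumptions

variable {k : Kind} {d : ℕ}

/-- Local charges: self-adjoint, supported at one site, with integer spectrum. -/
def IsCharge (q : ∀ ℓ, Torus d ℓ → FullOp k d ℓ) : Prop :=
  ∀ ℓ x, q ℓ x ∈ localAlg k {x} ∧ IsSelfAdjoint (q ℓ x) ∧
    spectrum ℂ (q ℓ x) ⊆ Set.range (fun m : ℤ => (m : ℂ))

/-- The charge `Q_Γ` of the half torus. -/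
noncomputable def halfCharge [NeZero d] (q : ∀ ℓ, Torus d ℓ → FullOp k d ℓ) (ℓ : ℕ) :
    FullOp k d ℓ :=
  ∑ x ∈ halfTorus d ℓ, q ℓ x

/-- Almost local unitaries. -/
def IsAlmostLocalUnitary (U : ∀ ℓ, Obs k d ℓ) : Prop :=
  (∀ ℓ, (U ℓ : FullOp k d ℓ) ∈ unitary (FullOp k d ℓ)) ∧
  ∃ g : ℕ → ℝ, RapidDecay g ∧ ∀ (ℓ : ℕ) (X : Finset (Torus d ℓ)), ∀ A ∈ localAlg k X, ∀ n : ℕ,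
    ∃ R ∈ localAlg k (fatten X n),
      ‖star (U ℓ : FullOp k d ℓ) * A * (U ℓ : FullOp k d ℓ) - R‖ ≤ g n * (‖A‖ * X.card)

/-- Local charge conservation: `U* Q U - Q = T₋ + T₊ + O(L ^ (-∞))` with self-adjoint `T₋`, `T₊`
supported in the two strips. -/
def LocalChargeConservation [NeZero d] (q : ∀ ℓ, Torus d ℓ → FullOp k d ℓ)
    (U Tm Tp : ∀ ℓ, Obs k d ℓ) : Prop :=
  (∀ ℓ, IsSelfAdjoint (Tm ℓ) ∧ (Tm ℓ : FullOp k d ℓ) ∈ localAlg k (stripMinus d ℓ)) ∧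
  (∀ ℓ, IsSelfAdjoint (Tp ℓ) ∧ (Tp ℓ : FullOp k d ℓ) ∈ localAlg k (stripPlus d ℓ)) ∧
  RapidDecay fun ℓ => ‖star (U ℓ : FullOp k d ℓ) * halfCharge q ℓ * (U ℓ : FullOp k d ℓ) -
    halfCharge q ℓ - (Tm ℓ : FullOp k d ℓ) - (Tp ℓ : FullOp k d ℓ)‖

/-- The constraint on the splitting: `exp (2πi (Q + T₋)) = 1 + O(L ^ (-∞))` and
`‖T₋‖, ‖T₊‖ ≤ C |Λ|`. -/
def SplittingConstraint [NeZero d] (q : ∀ ℓ, Torus d ℓ → FullOp k d ℓ)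
    (Tm Tp : ∀ ℓ, Obs k d ℓ) : Prop :=
  (RapidDecay fun ℓ => ‖NormedSpace.exp
    ((2 * Real.pi * Complex.I : ℂ) • (halfCharge q ℓ + (Tm ℓ : FullOp k d ℓ))) - 1‖) ∧
  ∃ C : ℝ, ∀ ℓ, 1 ≤ ℓ → ‖Tm ℓ‖ ≤ C * Fintype.card (Torus d ℓ) ∧
    ‖Tp ℓ‖ ≤ C * Fintype.card (Torus d ℓ)

/-- Local charge fluctuations: `Ω` is an approximate eigenvector of `Q - K₋ - K₊` with self-adjoint
`K₋`, `K₊` supported near the two boundaries of the half torus, with `‖K₋‖, ‖K₊‖ ≤ C |Λ|`. -/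
def LocalChargeFluctuations [NeZero d] (q : ∀ ℓ, Torus d ℓ → FullOp k d ℓ)
    (Ω : ∀ ℓ, Hilb k d ℓ) : Prop :=
  ∃ Km Kp : ∀ ℓ, FullOp k d ℓ,
    (∀ ℓ, IsSelfAdjoint (Km ℓ) ∧
      Km ℓ ∈ localAlg k (fatten (bdryMinus d ℓ) ((2 * ℓ : ℝ) / 16))) ∧
    (∀ ℓ, IsSelfAdjoint (Kp ℓ) ∧
      Kp ℓ ∈ localAlg k (fatten (bdryPlus d ℓ) ((2 * ℓ : ℝ) / 16))) ∧
    (∃ C : ℝ, ∀ ℓ, 1 ≤ ℓ → ‖Km ℓ‖ ≤ C * Fintype.card (Torus d ℓ) ∧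
      ‖Kp ℓ‖ ≤ C * Fintype.card (Torus d ℓ)) ∧
    RapidDecay fun ℓ => variance (Ω ℓ) (halfCharge q ℓ - Km ℓ - Kp ℓ)

/-- Exponential clustering in the `x₁`-direction, uniformly in the size of the torus. -/
def IsClustering [NeZero d] (ψ : ∀ ℓ, Hilb k d ℓ) : Prop :=
  ∃ c C : ℝ, 0 < c ∧ 0 < C ∧ ∀ (ℓ : ℕ) (X X' : Finset (Torus d ℓ)),
    ∀ A ∈ localAlg k X, ∀ B ∈ localAlg k X',
      ‖expect (ψ ℓ) (A * B) - expect (ψ ℓ) A * expect (ψ ℓ) B‖ ≤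
        C * ‖A‖ * ‖B‖ * X.card * X'.card * Real.exp (-c * dist₁ X X')

end Assumptions

end ManyBodyIndex

open ManyBodyIndex

/-!
The expectation of `T₋` is an integer up to `O(L ^ (-∞))`, for the following reason.

Split the charge of the half torus as `Q = Q₀ + Q₋ + Q₊`, where `Q₋` and `Q₊` collect the sites in
the two strips. Let `R₋`, `R₊` be approximations of `U* K₋ U`, `U* K₊ U` in the strips, which exist
because `U` is almost local, and put `X₋ = Q₋ - K₋`, `Y₋ = Q₋ + T₋ - R₋`, and similarly `X₊`, `Y₊`.
Then `Ω` is an approximate eigenvector of the corrected charge `X = Q₀ + X₋ + X₊`, hence, as `U`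
preserves `Ω` and `U* X U ≈ Y = Q₀ + Y₋ + Y₊`, also of `Y`, with the same eigenvalue. Since the
algebras of the strips commute with each other and with `Q₀`, the unitary `exp (i t Y) exp (-i t X)`
is the product of `W₋ t = exp (i t Y₋) exp (-i t X₋)` and its counterpart `W₊ t` in the other strip.
The product nearly fixes `Ω`, so clustering makes `Ω` an approximate eigenvector of each factor
(`SplitModel.one_sub_norm_mean_Wm_sq_le`).

The curve `w t = ⟨Ω, W₋ t Ω⟩` is then evaluated at `t = 2π` in two ways.
* Its derivative is nearly `i ⟨Ω, T₋ Ω⟩ w`, because inside the strip `X₋` and `X` generate the same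
  dynamics, which preserves the state, and because `⟨Ω, R₋ Ω⟩ ≈ ⟨Ω, K₋ Ω⟩`; so `w (2π)` is nearly
  `exp (2πi ⟨Ω, T₋ Ω⟩)` (`SplitModel.norm_deriv_mean_Wm_sub_le`).
* As `Q₀`, `Q₋`, `Q₊` have integer spectrum, the splitting constraint gives
  `exp (2πi Y₋) ≈ U* exp (2πi X₋) U`; as `Ω` is an approximate eigenvector of both `U` and
  `exp (2πi X₋)`, again by clustering, `w (2π)` is nearly `1`
  (`SplitModel.norm_mean_Wm_two_pi_sub_one_le`).

Norms of the charges never enter, so no bound on them is needed; the other polynomially growing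
norms are absorbed by the superpolynomially small errors. The limit of `⟨Ω, T₋ Ω⟩` exists since
weak-* convergent sequences are bounded, and it is an integer since `exp (2πi ·)` is continuous.

On the lattice this uses that the algebras of disjoint regions commute (`localAlg_commute`), which
for fermions comes from the anticommutation relations (`ladder_anticomm`).
-/

namespace ManyBodyIndex

/-! ### One-parameter unitary groups -/

/-- The mean value inequality on the whole line. -/
lemma norm_sub_le_of_deriv {E : Type*} [NormedAddCommGroup E] [NormedSpace ℝ E] {f f' : ℝ → E}
    {C : ℝ} (hf : ∀ t, HasDerivAt f (f' t) t) (hC : ∀ t, ‖f' t‖ ≤ C) (t : ℝ) :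
    ‖f t - f 0‖ ≤ C * |t| := by
  simpa using Convex.norm_image_sub_le_of_norm_hasDerivWithin_le
    (fun x _ => (hf x).hasDerivWithinAt) (fun x _ => hC x) convex_univ (Set.mem_univ 0)
    (Set.mem_univ t)

lemma norm_cexp_mul_I (s κ : ℝ) : ‖Complex.exp (s * κ * Complex.I)‖ = 1 := by
  rw [← Complex.ofReal_mul]
  exact Complex.norm_exp_ofReal_mul_I _

lemma norm_cexp_neg_mul_I (s κ : ℝ) : ‖Complex.exp (-(s * κ * Complex.I))‖ = 1 := by
  simpa using norm_cexp_mul_I (-s) κ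

lemma hasDerivAt_cexp_neg_mul_I (κ s : ℝ) :
    HasDerivAt (fun s : ℝ => Complex.exp (-(s * κ * Complex.I)))
      (Complex.exp (-(s * κ * Complex.I)) * -(κ * Complex.I)) s := by
  have h1 : HasDerivAt (fun s : ℂ => -(s * κ * Complex.I)) (-(κ * Complex.I)) (s : ℂ) := by
    have h2 := (((hasDerivAt_id (s : ℂ)).mul_const (κ : ℂ)).mul_const Complex.I).neg
    rw [one_mul] at h2
    exact h2
  exact h1.cexp.comp_ofReal

section Abstract

variable {H : Type*} [NormedAddCommGroup H] [InnerProductSpace ℂ H] [CompleteSpace H]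

/-- The one-parameter group `exp (i t A)`. -/
noncomputable def expI (A : H →L[ℂ] H) (t : ℝ) : H →L[ℂ] H :=
  NormedSpace.exp ((t : ℂ) • (Complex.I • A))

lemma expI_zero (A : H →L[ℂ] H) : expI A 0 = 1 := by simp [expI]

lemma expI_add {A B : H →L[ℂ] H} (h : Commute A B) (t : ℝ) :
    expI (A + B) t = expI A t * expI B t := by
  let +nondep : NormedAlgebra ℚ (H →L[ℂ] H) := .restrictScalars ℚ ℂ _
  rw [expI, expI, expI, smul_add, smul_add]
  refine NormedSpace.exp_add_of_commute ?_
  exact (((h.smul_left Complex.I).smul_right Complex.I).smul_left _).smul_right _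

lemma star_expI {A : H →L[ℂ] H} (hA : IsSelfAdjoint A) (t : ℝ) :
    star (expI A t) = expI A (-t) := by
  let +nondep : NormedAlgebra ℚ (H →L[ℂ] H) := .restrictScalars ℚ ℂ _
  rw [expI, NormedSpace.star_exp, expI]
  congr 1
  simp [star_smul, hA.star_eq]

lemma expI_mem_unitary {A : H →L[ℂ] H} (hA : IsSelfAdjoint A) (t : ℝ) :
    expI A t ∈ unitary (H →L[ℂ] H) := by
  have h : IsSelfAdjoint ((t : ℂ) • A) := by
    rw [IsSelfAdjoint, star_smul, hA.star_eq]; simp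
  have := (selfAdjoint.expUnitary (⟨_, h⟩ : selfAdjoint (H →L[ℂ] H))).2
  rwa [selfAdjoint.expUnitary_coe, smul_comm] at this

lemma Commute.expI {A B : H →L[ℂ] H} (h : Commute A B) (t : ℝ) : Commute A (expI B t) := by
  let +nondep : NormedAlgebra ℚ (H →L[ℂ] H) := .restrictScalars ℚ ℂ _
  exact ((h.smul_right Complex.I).smul_right _).exp_right

lemma hasDerivAt_expI (A : H →L[ℂ] H) (t : ℝ) :
    HasDerivAt (expI A) (expI A t * (Complex.I • A)) t := by
  have h := (hasDerivAt_exp_smul_const (𝕂 := ℂ) (Complex.I • A) (t : ℂ)).scomp t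
    Complex.ofRealCLM.hasDerivAt
  rw [Complex.ofRealCLM_apply, Complex.ofReal_one, one_smul] at h
  exact h

lemma hasDerivAt_expI_neg (A : H →L[ℂ] H) (t : ℝ) :
    HasDerivAt (fun s => expI A (-s)) (-((Complex.I • A) * expI A (-t))) t := by
  have h := (hasDerivAt_expI A (-t)).scomp t (hasDerivAt_neg t)
  have hc : Commute (Complex.I • A) (expI A (-t)) :=
    ((Commute.refl A).expI _).smul_left _
  rw [hc.eq, ← neg_one_smul ℝ]
  exact h

lemma expI_conj {U : H →L[ℂ] H} (hU : U ∈ unitary (H →L[ℂ] H)) (A : H →L[ℂ] H) (t : ℝ) :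
    expI (star U * A * U) t = star U * expI A t * U := by
  let +nondep : NormedAlgebra ℚ (H →L[ℂ] H) := .restrictScalars ℚ ℂ _
  have h := NormedSpace.exp_units_conj' (Unitary.toUnits ⟨U, hU⟩) ((t : ℂ) • (Complex.I • A))
  rw [mul_smul_comm, mul_smul_comm, smul_mul_assoc, smul_mul_assoc] at h
  exact h

lemma expI_mem {M : StarSubalgebra ℂ (H →L[ℂ] H)} (hM : IsClosed (M : Set (H →L[ℂ] H)))
    {A : H →L[ℂ] H} (hA : A ∈ M) (t : ℝ) : expI A t ∈ M := by
  let +nondep : NormedAlgebra ℚ (H →L[ℂ] H) := .restrictScalars ℚ ℂ _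
  have h : (t : ℂ) • (Complex.I • A) ∈ M := M.smul_mem (M.smul_mem hA _) _
  let +nondep : Algebra ℚ M := Algebra.compHom M (algebraMap ℚ ℂ)
  exact NormedSpace.exp_mem hM h

lemma hasDerivAt_expI_mul_expI_neg (A B : H →L[ℂ] H) (t : ℝ) :
    HasDerivAt (fun s => expI A s * expI B (-s))
      (Complex.I • (expI A t * (A - B) * expI B (-t))) t := by
  refine ((hasDerivAt_expI A t).mul (hasDerivAt_expI_neg B t)).congr_deriv ?_
  simp [sub_eq_add_neg, add_mul, mul_add, mul_assoc]

lemma norm_expI_sub_expI_le {A B : H →L[ℂ] H} (hA : IsSelfAdjoint A) (hB : IsSelfAdjoint B)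
    (t : ℝ) : ‖expI A t - expI B t‖ ≤ ‖A - B‖ * |t| := by
  have h := norm_sub_le_of_deriv (hasDerivAt_expI_mul_expI_neg A B) (C := ‖A - B‖) (fun s => by
    rw [norm_smul, Complex.norm_I, one_mul,
      CStarRing.norm_mul_mem_unitary _ (expI_mem_unitary hB _),
      CStarRing.norm_mem_unitary_mul _ (expI_mem_unitary hA _)]) t
  have hB' := expI_mem_unitary hB t
  rw [← CStarRing.norm_mul_mem_unitary _ hB'] at h
  simpa [expI_zero, sub_mul, mul_assoc, ← star_expI hB, Unitary.star_mul_self_of_mem hB'] using h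

/-- An approximate eigenvector of `A` is one of the unitary group of `A`. -/
lemma norm_expI_apply_sub_le {A : H →L[ℂ] H} (hA : IsSelfAdjoint A) (κ : ℝ) (Ω : H) (t : ℝ) :
    ‖expI A t Ω - Complex.exp (t * κ * Complex.I) • Ω‖ ≤ ‖A Ω - (κ : ℂ) • Ω‖ * |t| := by
  have hd : ∀ s : ℝ, HasDerivAt (fun s : ℝ => Complex.exp (-(s * κ * Complex.I)) • expI A s Ω)
      (Complex.exp (-(s * κ * Complex.I)) • Complex.I • expI A s (A Ω - (κ : ℂ) • Ω)) s :=
    fun s => by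
      have h2 : HasDerivAt (fun s => expI A s Ω) ((expI A s * (Complex.I • A)) Ω) s :=
        ((ContinuousLinearMap.apply ℂ H Ω).restrictScalars ℝ).hasFDerivAt.comp_hasDerivAt s
          (hasDerivAt_expI A s)
      refine ((hasDerivAt_cexp_neg_mul_I κ s).smul h2).congr_deriv ?_
      simp only [map_sub, map_smul, smul_sub, mul_apply_eq_comp,
        smul_apply]
      module
  have h := norm_sub_le_of_deriv hd (C := ‖A Ω - (κ : ℂ) • Ω‖) (fun s => by
    rw [norm_smul, norm_smul, norm_cexp_neg_mul_I, Complex.norm_I, one_mul, one_mul,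
      ContinuousLinearMap.norm_map_of_mem_unitary (expI_mem_unitary hA _)]) t
  have h3 : expI A t Ω - Complex.exp (t * κ * Complex.I) • Ω = Complex.exp (t * κ * Complex.I) •
      (Complex.exp (-(t * κ * Complex.I)) • expI A t Ω - Ω) := by
    rw [smul_sub, smul_smul, ← Complex.exp_add]; simp
  rw [h3, norm_smul, norm_cexp_mul_I, one_mul]
  simpa [expI_zero] using h

end Abstract

/-! ### Expectations in approximate eigenvectors -/

/-- A curve which nearly solves `w' = i τ w`, `w 0 = 1`, nearly equals `exp (i τ t)`. -/
lemma norm_sub_exp_le {w w' : ℝ → ℂ} {τ δ : ℝ} (hw : ∀ t, HasDerivAt w (w' t) t)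
    (h0 : w 0 = 1) {T : ℝ} (hT : 0 ≤ T)
    (hδ : ∀ t ∈ Set.Icc 0 T, ‖w' t - Complex.I * τ * w t‖ ≤ δ) :
    ‖w T - Complex.exp (T * τ * Complex.I)‖ ≤ δ * T := by
  have hd : ∀ s : ℝ, HasDerivAt (fun s : ℝ => Complex.exp (-(s * τ * Complex.I)) * w s)
      (Complex.exp (-(s * τ * Complex.I)) * (w' s - Complex.I * τ * w s)) s := fun s =>
    ((hasDerivAt_cexp_neg_mul_I τ s).mul (hw s)).congr_deriv (by ring)
  have h := norm_image_sub_le_of_norm_deriv_le_segment'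
    (fun s _ => (hd s).hasDerivWithinAt) (C := δ) (fun s hs => by
      rw [norm_mul, norm_cexp_neg_mul_I, one_mul]
      exact hδ s (Set.Ico_subset_Icc_self hs)) T (Set.right_mem_Icc.2 hT)
  have h3 : w T - Complex.exp (T * τ * Complex.I) = Complex.exp (T * τ * Complex.I) *
      (Complex.exp (-(T * τ * Complex.I)) * w T - 1) := by
    rw [mul_sub, ← mul_assoc, ← Complex.exp_add]; simp
  rw [h3, norm_mul, norm_cexp_mul_I, one_mul]
  simpa [h0] using h

section Abstract

variable {H : Type*} [NormedAddCommGroup H] [InnerProductSpace ℂ H]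

/-- The expectation of `A` in the vector state of `Ω`. -/
noncomputable def mean (Ω : H) (A : H →L[ℂ] H) : ℂ := inner ℂ Ω (A Ω)

lemma norm_sub_inner_smul_sq {a b : H} (ha : ‖a‖ = 1) (hb : ‖b‖ = 1) :
    ‖a - inner ℂ b a • b‖ ^ 2 = 1 - ‖inner ℂ b a‖ ^ 2 := by
  rw [@norm_sub_sq ℂ, norm_smul, ha, hb, inner_smul_right, ← inner_conj_symm a b,
    Complex.mul_conj, Complex.normSq_eq_norm_sq]
  simp [-Complex.ofReal_pow]
  ring

lemma norm_mean_le {Ω : H} (hΩ : ‖Ω‖ = 1) (A : H →L[ℂ] H) : ‖mean Ω A‖ ≤ ‖A‖ := by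
  refine (norm_inner_le_norm _ _).trans ?_
  rw [hΩ, one_mul]
  simpa [hΩ] using A.le_opNorm Ω

/-- Vector states of nearby rays have nearby expectations. -/
lemma norm_inner_sub_mean_le {a Ω : H} (ha : ‖a‖ = 1) (hΩ : ‖Ω‖ = 1) {v : ℂ} (hv : ‖v‖ ≤ 1)
    {ε : ℝ} (h : ‖a - v • Ω‖ ≤ ε) (A : H →L[ℂ] H) :
    ‖inner ℂ a (A a) - mean Ω A‖ ≤ 4 * ε * ‖A‖ := by
  have hA : ∀ x : H, ‖x‖ ≤ 1 → ‖A x‖ ≤ ‖A‖ := fun x hx =>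
    (A.le_opNorm x).trans (mul_le_of_le_one_right (norm_nonneg _) hx)
  have hvΩ : ‖v • Ω‖ ≤ 1 := by rwa [norm_smul, hΩ, mul_one]
  have h1 : ‖inner ℂ (a - v • Ω) (A a)‖ ≤ ε * ‖A‖ :=
    (norm_inner_le_norm _ _).trans (mul_le_mul h (hA a ha.le) (norm_nonneg _)
      ((norm_nonneg _).trans h))
  have h2 : ‖inner ℂ (v • Ω) (A (a - v • Ω))‖ ≤ ε * ‖A‖ := by
    refine (norm_inner_le_norm _ _).trans ?_
    refine (mul_le_of_le_one_left (norm_nonneg _) hvΩ).trans ?_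
    rw [mul_comm]
    exact (A.le_opNorm _).trans (mul_le_mul_of_nonneg_left h (norm_nonneg _))
  have h3 : ‖((‖v‖ ^ 2 - 1 : ℝ) : ℂ) * mean Ω A‖ ≤ 2 * ε * ‖A‖ := by
    rw [norm_mul, Complex.norm_real, Real.norm_eq_abs]
    refine mul_le_mul ?_ (norm_mean_le hΩ A) (norm_nonneg _)
      (mul_nonneg zero_le_two ((norm_nonneg _).trans h))
    have h4 : 1 - ‖v‖ ≤ ε := by
      have := norm_sub_norm_le a (v • Ω)
      rw [norm_smul, ha, hΩ, mul_one] at this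
      linarith
    rw [abs_sub_comm, abs_of_nonneg (by nlinarith [norm_nonneg v])]
    nlinarith [norm_nonneg v]
  have h5 : inner ℂ a (A a) - mean Ω A = inner ℂ (a - v • Ω) (A a) +
      inner ℂ (v • Ω) (A (a - v • Ω)) + ((‖v‖ ^ 2 - 1 : ℝ) : ℂ) * mean Ω A := by
    have h6 : ((‖v‖ ^ 2 : ℝ) : ℂ) = starRingEnd ℂ v * v := by
      rw [← Complex.normSq_eq_norm_sq, Complex.normSq_eq_conj_mul_self]
    rw [Complex.ofReal_sub, h6, mean]
    simp only [map_sub, map_smul, inner_sub_left, inner_sub_right, inner_smul_left,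
      inner_smul_right, Complex.ofReal_one]
    ring
  rw [h5]
  refine norm_add₃_le.trans ?_
  linarith

variable [CompleteSpace H]

lemma norm_le_one_of_mem_unitary {V : H →L[ℂ] H} (hV : V ∈ unitary (H →L[ℂ] H)) : ‖V‖ ≤ 1 :=
  V.opNorm_le_bound zero_le_one fun x => by
    rw [ContinuousLinearMap.norm_map_of_mem_unitary hV, one_mul]

lemma mean_star (Ω : H) (A : H →L[ℂ] H) : mean Ω (star A) = starRingEnd ℂ (mean Ω A) := by
  rw [mean, mean, ContinuousLinearMap.star_eq_adjoint, ContinuousLinearMap.adjoint_inner_right,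
    inner_conj_symm]

/-- The closer the expectation of a unitary is to the unit circle, the closer `Ω` is to an
eigenvector of its adjoint. -/
lemma norm_star_apply_sub_mean_sq {Ω : H} (hΩ : ‖Ω‖ = 1) {V : H →L[ℂ] H}
    (hV : V ∈ unitary (H →L[ℂ] H)) :
    ‖star V Ω - starRingEnd ℂ (mean Ω V) • Ω‖ ^ 2 = 1 - ‖mean Ω V‖ ^ 2 := by
  have h := norm_sub_inner_smul_sq (a := star V Ω) (b := Ω)
    (by rw [ContinuousLinearMap.norm_map_of_mem_unitary (Unitary.star_mem hV), hΩ]) hΩ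
  change ‖star V Ω - mean Ω (star V) • Ω‖ ^ 2 = 1 - ‖mean Ω (star V)‖ ^ 2 at h
  rwa [mean_star, RCLike.norm_conj] at h

/-- If two unitaries are uncorrelated in `Ω` and `Ω` is an eigenvector of their product, up to
small errors, then the expectation of the first one is close to the unit circle. -/
lemma one_sub_norm_mean_sq_le {Ω : H} (hΩ : ‖Ω‖ = 1) {V W : H →L[ℂ] H}
    (hV : V ∈ unitary (H →L[ℂ] H)) (hW : W ∈ unitary (H →L[ℂ] H)) {z : ℂ} (hz : ‖z‖ = 1)
    {δ ε : ℝ} (hδ : ‖(V * W) Ω - z • Ω‖ ≤ δ)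
    (hε : ‖mean Ω (V * W) - mean Ω V * mean Ω W‖ ≤ ε) :
    1 - ‖mean Ω V‖ ^ 2 ≤ 2 * (δ + ε) := by
  have h1 : ‖mean Ω (V * W) - z‖ ≤ δ := by
    have : mean Ω (V * W) - z = inner ℂ Ω ((V * W) Ω - z • Ω) := by
      rw [inner_sub_right, inner_smul_right, inner_self_eq_norm_sq_to_K, hΩ, mean]; simp
    rw [this]
    refine (norm_inner_le_norm _ _).trans ?_
    rwa [hΩ, one_mul]
  have h2 : 1 ≤ ‖mean Ω V‖ * ‖mean Ω W‖ + δ + ε := by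
    rw [← norm_mul]
    have h3 := norm_add₃_le (a := mean Ω V * mean Ω W)
      (b := mean Ω (V * W) - mean Ω V * mean Ω W) (c := -(mean Ω (V * W) - z))
    rw [norm_neg] at h3
    have h4 : mean Ω V * mean Ω W + (mean Ω (V * W) - mean Ω V * mean Ω W) +
      -(mean Ω (V * W) - z) = z := by ring
    rw [h4, hz] at h3
    linarith
  have hV1 := (norm_mean_le hΩ V).trans (norm_le_one_of_mem_unitary hV)
  have hW1 := (norm_mean_le hΩ W).trans (norm_le_one_of_mem_unitary hW)
  have hV0 := norm_nonneg (mean Ω V)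
  nlinarith

end Abstract

/-! ### The index up to an explicit error -/

/-- A charge `Q₀ + Q₋ + Q₊` with integer spectrum, two commuting algebras `M ∋ Q₋` and `P ∋ Q₊`
which commute with `Q₀` and are almost uncorrelated in the state `Ω`, and a unitary `U` almost
preserving `Ω` which transports the charge `T₋` in `M` and `T₊` in `P`. The operators `K₋`, `K₊`
correct the fluctuations of the charge in `Ω`, and `R₋`, `R₊` are local approximations of
`U* K₋ U`, `U* K₊ U`. All errors are bounded by `ε` and all relevant operators of `M` by `N`. -/
structure SplitModel (H : Type*) [NormedAddCommGroup H] [InnerProductSpace ℂ H]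
    [CompleteSpace H] where
  /-- The state. -/
  Ω : H
  norm_Ω : ‖Ω‖ = 1
  /-- The algebra of the first strip. -/
  M : StarSubalgebra ℂ (H →L[ℂ] H)
  /-- The algebra of the second strip. -/
  P : StarSubalgebra ℂ (H →L[ℂ] H)
  isClosed_M : IsClosed (M : Set (H →L[ℂ] H))
  isClosed_P : IsClosed (P : Set (H →L[ℂ] H))
  comm : ∀ A ∈ M, ∀ B ∈ P, Commute A B
  /-- The transport unitary. -/
  U : H →L[ℂ] H
  U_mem : U ∈ unitary (H →L[ℂ] H)
  /-- The charge away from the strips. -/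
  Q₀ : H →L[ℂ] H
  /-- The charge in the first strip. -/
  Qm : H →L[ℂ] H
  /-- The charge in the second strip. -/
  Qp : H →L[ℂ] H
  /-- The charge transported in the first strip. -/
  Tm : H →L[ℂ] H
  /-- The charge transported in the second strip. -/
  Tp : H →L[ℂ] H
  /-- The fluctuation correction in the first strip. -/
  Km : H →L[ℂ] H
  /-- The fluctuation correction in the second strip. -/
  Kp : H →L[ℂ] H
  /-- A local approximation of `U* K₋ U`. -/
  Rm : H →L[ℂ] H
  /-- A local approximation of `U* K₊ U`. -/
  Rp : H →L[ℂ] H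
  sa_Q₀ : IsSelfAdjoint Q₀
  sa_Qm : IsSelfAdjoint Qm
  sa_Qp : IsSelfAdjoint Qp
  sa_Tm : IsSelfAdjoint Tm
  sa_Tp : IsSelfAdjoint Tp
  sa_Km : IsSelfAdjoint Km
  sa_Kp : IsSelfAdjoint Kp
  sa_Rm : IsSelfAdjoint Rm
  sa_Rp : IsSelfAdjoint Rp
  Qm_mem : Qm ∈ M
  Tm_mem : Tm ∈ M
  Km_mem : Km ∈ M
  Rm_mem : Rm ∈ M
  Qp_mem : Qp ∈ P
  Tp_mem : Tp ∈ P
  Kp_mem : Kp ∈ P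
  Rp_mem : Rp ∈ P
  comm_M : ∀ A ∈ M, Commute Q₀ A
  comm_P : ∀ A ∈ P, Commute Q₀ A
  exp_Q₀ : expI Q₀ (2 * Real.pi) = 1
  exp_Qm : expI Qm (2 * Real.pi) = 1
  exp_Qp : expI Qp (2 * Real.pi) = 1
  /-- The approximate eigenvalue of the corrected charge. -/
  κ : ℝ
  /-- The bound on the operators of the first strip. -/
  N : ℝ
  /-- The bound on all errors. -/
  ε : ℝ
  ε_le_one : ε ≤ 1
  transport : ‖star U * (Q₀ + Qm + Qp) * U - (Q₀ + Qm + Qp) - Tm - Tp‖ ≤ ε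
  invariant : ‖U Ω - mean Ω U • Ω‖ ≤ ε
  fluctuation : ‖(Q₀ + Qm + Qp - Km - Kp) Ω - (κ : ℂ) • Ω‖ ≤ ε
  splitting : ‖expI (Q₀ + Qm + Qp + Tm) (2 * Real.pi) - 1‖ ≤ ε
  approx_Km : ‖star U * Km * U - Rm‖ ≤ ε
  approx_Kp : ‖star U * Kp * U - Rp‖ ≤ ε
  cluster : ∀ A ∈ M, ∀ B ∈ P, ‖mean Ω (A * B) - mean Ω A * mean Ω B‖ ≤ ε * (‖A‖ * ‖B‖)
  norm_Tm : ‖Tm‖ ≤ N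
  norm_Km : ‖Km‖ ≤ N
  norm_Rm : ‖Rm‖ ≤ N

namespace SplitModel

variable {H : Type*} [NormedAddCommGroup H] [InnerProductSpace ℂ H] [CompleteSpace H]
  (S : SplitModel H)

/-- The part in `M` of the corrected charge. -/
noncomputable def Xm : H →L[ℂ] H := S.Qm - S.Km

/-- The part in `P` of the corrected charge. -/
noncomputable def Xp : H →L[ℂ] H := S.Qp - S.Kp

/-- The part in `M` of the transported corrected charge. -/
noncomputable def Ym : H →L[ℂ] H := S.Qm + S.Tm - S.Rm

/-- The part in `P` of the transported corrected charge. -/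
noncomputable def Yp : H →L[ℂ] H := S.Qp + S.Tp - S.Rp

lemma Xm_mem : S.Xm ∈ S.M := sub_mem S.Qm_mem S.Km_mem
lemma Xp_mem : S.Xp ∈ S.P := sub_mem S.Qp_mem S.Kp_mem
lemma Ym_mem : S.Ym ∈ S.M := sub_mem (add_mem S.Qm_mem S.Tm_mem) S.Rm_mem
lemma Yp_mem : S.Yp ∈ S.P := sub_mem (add_mem S.Qp_mem S.Tp_mem) S.Rp_mem
lemma sa_Xm : IsSelfAdjoint S.Xm := S.sa_Qm.sub S.sa_Km
lemma sa_Xp : IsSelfAdjoint S.Xp := S.sa_Qp.sub S.sa_Kp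
lemma sa_Ym : IsSelfAdjoint S.Ym := (S.sa_Qm.add S.sa_Tm).sub S.sa_Rm
lemma sa_Yp : IsSelfAdjoint S.Yp := (S.sa_Qp.add S.sa_Tp).sub S.sa_Rp

/-- The corrected charge, of which `Ω` is an approximate eigenvector. -/
noncomputable def X : H →L[ℂ] H := S.Q₀ + (S.Xm + S.Xp)

/-- The transported corrected charge, approximately `U* X U`. -/
noncomputable def Y : H →L[ℂ] H := S.Q₀ + (S.Ym + S.Yp)

lemma sa_X : IsSelfAdjoint S.X := S.sa_Q₀.add (S.sa_Xm.add S.sa_Xp)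
lemma sa_Y : IsSelfAdjoint S.Y := S.sa_Q₀.add (S.sa_Ym.add S.sa_Yp)

/-- The summands of the charge commute, so exponentials factor over the strips. -/
lemma expI_split {A B : H →L[ℂ] H} (hA : A ∈ S.M) (hB : B ∈ S.P) (t : ℝ) :
    expI (S.Q₀ + (A + B)) t = expI S.Q₀ t * (expI A t * expI B t) := by
  rw [expI_add ((S.comm_M A hA).add_right (S.comm_P B hB)), expI_add (S.comm A hA B hB)]

lemma ε_nonneg : 0 ≤ S.ε := (norm_nonneg _).trans S.invariant

lemma N_nonneg : 0 ≤ S.N := (norm_nonneg _).trans S.norm_Tm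

lemma norm_mean_U : ‖mean S.Ω S.U‖ ≤ 1 :=
  (norm_mean_le S.norm_Ω _).trans (norm_le_one_of_mem_unitary S.U_mem)

lemma norm_expI_X_apply (t : ℝ) :
    ‖expI S.X t S.Ω - Complex.exp (t * S.κ * Complex.I) • S.Ω‖ ≤ S.ε * |t| := by
  refine (norm_expI_apply_sub_le S.sa_X S.κ S.Ω t).trans ?_
  refine mul_le_mul_of_nonneg_right ?_ (abs_nonneg t)
  have h : S.X = S.Q₀ + S.Qm + S.Qp - S.Km - S.Kp := by simp only [X, Xm, Xp]; abel
  rw [h]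
  exact S.fluctuation

lemma norm_conj_X_sub_Y : ‖star S.U * S.X * S.U - S.Y‖ ≤ 3 * S.ε := by
  have h : star S.U * S.X * S.U - S.Y =
      (star S.U * (S.Q₀ + S.Qm + S.Qp) * S.U - (S.Q₀ + S.Qm + S.Qp) - S.Tm - S.Tp) +
      -(star S.U * S.Km * S.U - S.Rm) + -(star S.U * S.Kp * S.U - S.Rp) := by
    simp only [X, Y, Xm, Xp, Ym, Yp]; noncomm_ring
  rw [h]
  refine norm_add₃_le.trans ?_
  rw [norm_neg, norm_neg]
  linarith [S.transport, S.approx_Km, S.approx_Kp]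

lemma isSelfAdjoint_conj {A : H →L[ℂ] H} (hA : IsSelfAdjoint A) (U : H →L[ℂ] H) :
    IsSelfAdjoint (star U * A * U) := by
  simp [IsSelfAdjoint, hA.star_eq, mul_assoc]

/-- `Ω` is also an approximate eigenvector of the transported corrected charge, with the same
eigenvalue. The errors are measured on the unitary groups as there is no bound on the charges. -/
lemma norm_expI_Y_apply (t : ℝ) :
    ‖expI S.Y t S.Ω - Complex.exp (t * S.κ * Complex.I) • S.Ω‖ ≤ S.ε * (4 * |t| + 2) := by
  set z := Complex.exp (t * S.κ * Complex.I) with hz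
  set u := mean S.Ω S.U
  have hzn : ‖z‖ = 1 := norm_cexp_mul_I _ _
  have hX := S.norm_expI_X_apply t
  have h1 : ‖(expI S.Y t - star S.U * expI S.X t * S.U) S.Ω‖ ≤ 3 * S.ε * |t| := by
    refine (ContinuousLinearMap.le_opNorm _ _).trans ?_
    rw [S.norm_Ω, mul_one, ← expI_conj S.U_mem, norm_sub_rev]
    exact (norm_expI_sub_expI_le (isSelfAdjoint_conj S.sa_X _) S.sa_Y t).trans
      (mul_le_mul_of_nonneg_right S.norm_conj_X_sub_Y (abs_nonneg t))
  have h2 : ‖expI S.X t (S.U S.Ω) - z • S.U S.Ω‖ ≤ S.ε * |t| + 2 * S.ε := by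
    have h3 : expI S.X t (S.U S.Ω) - z • S.U S.Ω = expI S.X t (S.U S.Ω - u • S.Ω) +
        u • (expI S.X t S.Ω - z • S.Ω) + -(z • (S.U S.Ω - u • S.Ω)) := by
      simp only [map_sub, map_smul]
      module
    rw [h3]
    refine norm_add₃_le.trans ?_
    rw [norm_neg, norm_smul, norm_smul, hzn,
      ContinuousLinearMap.norm_map_of_mem_unitary (expI_mem_unitary S.sa_X t)]
    have := mul_le_of_le_one_left (norm_nonneg (expI S.X t S.Ω - z • S.Ω)) S.norm_mean_U
    linarith [S.invariant]
  have h3 : (star S.U) (S.U S.Ω) = S.Ω := by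
    rw [← mul_apply_eq_comp, Unitary.star_mul_self_of_mem S.U_mem, one_apply_eq_self]
  have h4 : expI S.Y t S.Ω - z • S.Ω = (expI S.Y t - star S.U * expI S.X t * S.U) S.Ω +
      star S.U (expI S.X t (S.U S.Ω) - z • S.U S.Ω) := by
    simp only [map_sub, map_smul, h3, mul_assoc, mul_apply_eq_comp, sub_apply]
    abel
  rw [h4]
  refine (norm_add_le _ _).trans ?_
  rw [ContinuousLinearMap.norm_map_of_mem_unitary (Unitary.star_mem S.U_mem)]
  linarith

/-- The part in `M` of the unitary `exp (i t Y) exp (-i t X)`. -/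
noncomputable def Wm (t : ℝ) : H →L[ℂ] H := expI S.Ym t * expI S.Xm (-t)

/-- The part in `P` of the unitary `exp (i t Y) exp (-i t X)`. -/
noncomputable def Wp (t : ℝ) : H →L[ℂ] H := expI S.Yp t * expI S.Xp (-t)

lemma Wm_mem (t : ℝ) : S.Wm t ∈ S.M :=
  mul_mem (expI_mem S.isClosed_M S.Ym_mem t) (expI_mem S.isClosed_M S.Xm_mem _)

lemma Wp_mem (t : ℝ) : S.Wp t ∈ S.P :=
  mul_mem (expI_mem S.isClosed_P S.Yp_mem t) (expI_mem S.isClosed_P S.Xp_mem _)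

lemma Wm_unitary (t : ℝ) : S.Wm t ∈ unitary (H →L[ℂ] H) :=
  mul_mem (expI_mem_unitary S.sa_Ym t) (expI_mem_unitary S.sa_Xm _)

lemma Wp_unitary (t : ℝ) : S.Wp t ∈ unitary (H →L[ℂ] H) :=
  mul_mem (expI_mem_unitary S.sa_Yp t) (expI_mem_unitary S.sa_Xp _)

lemma expI_mul_expI_neg {A : H →L[ℂ] H} (hA : IsSelfAdjoint A) (t : ℝ) :
    expI A t * expI A (-t) = 1 := by
  rw [← star_expI hA, Unitary.mul_star_self_of_mem (expI_mem_unitary hA t)]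

lemma expI_neg_mul_expI {A : H →L[ℂ] H} (hA : IsSelfAdjoint A) (t : ℝ) :
    expI A (-t) * expI A t = 1 := by
  simpa using expI_mul_expI_neg hA (-t)

lemma Wm_mul_Wp (t : ℝ) : S.Wm t * S.Wp t = expI S.Y t * expI S.X (-t) := by
  rw [Y, X, S.expI_split S.Ym_mem S.Yp_mem, S.expI_split S.Xm_mem S.Xp_mem, Wm, Wp]
  have h1 : Commute (expI S.Q₀ t) (expI S.Ym t * expI S.Yp t) :=
    (((S.comm_M _ (expI_mem S.isClosed_M S.Ym_mem t)).mul_right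
      (S.comm_P _ (expI_mem S.isClosed_P S.Yp_mem t))).symm.expI t).symm
  have h2 : Commute (expI S.Xm (-t)) (expI S.Yp t) :=
    S.comm _ (expI_mem S.isClosed_M S.Xm_mem _) _ (expI_mem S.isClosed_P S.Yp_mem t)
  calc expI S.Ym t * expI S.Xm (-t) * (expI S.Yp t * expI S.Xp (-t))
      = expI S.Ym t * (expI S.Xm (-t) * expI S.Yp t) * expI S.Xp (-t) := by
        simp only [mul_assoc]
    _ = (expI S.Ym t * expI S.Yp t) * (expI S.Q₀ t * expI S.Q₀ (-t)) *
        (expI S.Xm (-t) * expI S.Xp (-t)) := by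
        rw [h2.eq, expI_mul_expI_neg S.sa_Q₀]; simp only [mul_assoc, one_mul]
    _ = _ := by rw [h1.eq]; simp only [mul_assoc]

lemma cluster_unitary {V W : H →L[ℂ] H} (hV : V ∈ S.M) (hW : W ∈ S.P)
    (hV' : V ∈ unitary (H →L[ℂ] H)) (hW' : W ∈ unitary (H →L[ℂ] H)) :
    ‖mean S.Ω (V * W) - mean S.Ω V * mean S.Ω W‖ ≤ S.ε :=
  (S.cluster V hV W hW).trans (mul_le_of_le_one_right S.ε_nonneg
    (mul_le_one₀ (norm_le_one_of_mem_unitary hV') (norm_nonneg _)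
      (norm_le_one_of_mem_unitary hW')))

lemma abs_le_seven {t : ℝ} (ht : t ∈ Set.Icc 0 (2 * Real.pi)) : |t| ≤ 7 := by
  rw [abs_of_nonneg ht.1]
  linarith [ht.2, Real.pi_lt_d2]

/-- `Ω` is an approximate eigenvector of the unitaries `W₋ t`, by clustering. -/
lemma one_sub_norm_mean_Wm_sq_le {t : ℝ} (ht : t ∈ Set.Icc 0 (2 * Real.pi)) :
    1 - ‖mean S.Ω (S.Wm t)‖ ^ 2 ≤ 76 * S.ε := by
  have h7 := abs_le_seven ht
  have hε := S.ε_nonneg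
  have h1 : ‖(S.Wm t * S.Wp t) S.Ω - (1 : ℂ) • S.Ω‖ ≤ 37 * S.ε := by
    set z := Complex.exp (t * S.κ * Complex.I) with hz
    have hX := S.norm_expI_X_apply (-t)
    have hz' : Complex.exp (((-t : ℝ) : ℂ) * S.κ * Complex.I) = z⁻¹ := by
      rw [hz, ← Complex.exp_neg]; push_cast; ring_nf
    rw [hz', abs_neg] at hX
    have hzn : ‖z‖ = 1 := norm_cexp_mul_I _ _
    have hz0 : z ≠ 0 := Complex.exp_ne_zero _
    have hY := S.norm_expI_Y_apply t
    have h2 : (S.Wm t * S.Wp t) S.Ω - (1 : ℂ) • S.Ω =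
        expI S.Y t (expI S.X (-t) S.Ω - z⁻¹ • S.Ω) + z⁻¹ • (expI S.Y t S.Ω - z • S.Ω) := by
      rw [Wm_mul_Wp, map_sub, map_smul, smul_sub, smul_smul, inv_mul_cancel₀ hz0,
        mul_apply_eq_comp]
      abel
    rw [h2]
    refine (norm_add_le _ _).trans ?_
    rw [ContinuousLinearMap.norm_map_of_mem_unitary (expI_mem_unitary S.sa_Y t), norm_smul,
      norm_inv, hzn, inv_one, one_mul]
    nlinarith
  have := one_sub_norm_mean_sq_le S.norm_Ω (S.Wm_unitary t) (S.Wp_unitary t) norm_one h1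
    (S.cluster_unitary (S.Wm_mem t) (S.Wp_mem t) (S.Wm_unitary t) (S.Wp_unitary t))
  linarith

/-- Inside `M` the corrected charge generates the same dynamics as its part in `M`. -/
lemma expI_X_conj {D : H →L[ℂ] H} (hD : D ∈ S.M) (t : ℝ) :
    expI S.Xm t * D * expI S.Xm (-t) = expI S.X t * D * expI S.X (-t) := by
  have h : S.X = S.Xm + (S.Q₀ + S.Xp) := by rw [X]; abel
  have hc : ∀ A ∈ S.M, Commute A (S.Q₀ + S.Xp) := fun A hA =>
    (S.comm_M A hA).symm.add_right (S.comm A hA _ S.Xp_mem)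
  have h1 := hc _ S.Xm_mem
  have hsa : IsSelfAdjoint (S.Q₀ + S.Xp) := S.sa_Q₀.add S.sa_Xp
  rw [h, expI_add h1, expI_add h1]
  have h2 : Commute D (expI (S.Q₀ + S.Xp) t) := (hc D hD).expI t
  have h3 : Commute (expI S.Xm (-t)) (expI (S.Q₀ + S.Xp) (-t)) :=
    (hc _ (expI_mem S.isClosed_M S.Xm_mem _)).expI _
  calc expI S.Xm t * D * expI S.Xm (-t)
      = expI S.Xm t * D * (expI (S.Q₀ + S.Xp) t * expI (S.Q₀ + S.Xp) (-t)) * expI S.Xm (-t) := by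
        rw [expI_mul_expI_neg hsa, mul_one]
    _ = expI S.Xm t * (D * expI (S.Q₀ + S.Xp) t) *
        (expI (S.Q₀ + S.Xp) (-t) * expI S.Xm (-t)) := by simp only [mul_assoc]
    _ = _ := by rw [h2.eq, ← h3.eq]; simp only [mul_assoc]

lemma norm_D_le : ‖S.Ym - S.Xm‖ ≤ 3 * S.N := by
  have h : S.Ym - S.Xm = S.Tm + S.Km + -S.Rm := by simp only [Ym, Xm]; abel
  rw [h]
  refine norm_add₃_le.trans ?_
  rw [norm_neg]
  linarith [S.norm_Tm, S.norm_Km, S.norm_Rm]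

/-- `Y₋ - X₋ = T₋ + K₋ - R₋` has nearly the expectation of `T₋`, as `U` preserves the state. -/
lemma norm_mean_D_sub_le : ‖mean S.Ω (S.Ym - S.Xm) - mean S.Ω S.Tm‖ ≤ S.ε + 4 * S.ε * S.N := by
  have hK := norm_inner_sub_mean_le
    (by rw [ContinuousLinearMap.norm_map_of_mem_unitary S.U_mem, S.norm_Ω]) S.norm_Ω
    S.norm_mean_U S.invariant S.Km
  have hR := (norm_mean_le S.norm_Ω (star S.U * S.Km * S.U - S.Rm)).trans S.approx_Km
  have h1 : inner ℂ (S.U S.Ω) (S.Km (S.U S.Ω)) = mean S.Ω (star S.U * S.Km * S.U) := by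
    rw [mean, mul_assoc, mul_apply_eq_comp, ContinuousLinearMap.star_eq_adjoint,
      ContinuousLinearMap.adjoint_inner_right, mul_apply_eq_comp]
  rw [h1] at hK
  have h2 : mean S.Ω (S.Ym - S.Xm) - mean S.Ω S.Tm =
      mean S.Ω (star S.U * S.Km * S.U - S.Rm) -
      (mean S.Ω (star S.U * S.Km * S.U) - mean S.Ω S.Km) := by
    simp only [mean, Ym, Xm, sub_apply, add_apply, inner_sub_right, inner_add_right]
    ring
  rw [h2]
  refine (norm_sub_le _ _).trans ?_
  have := mul_le_mul_of_nonneg_left S.norm_Km (mul_nonneg zero_le_four S.ε_nonneg)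
  linarith

lemma hasDerivAt_mean_Wm (t : ℝ) : HasDerivAt (fun s => mean S.Ω (S.Wm s))
    (Complex.I * mean S.Ω (S.Wm t * (expI S.X t * (S.Ym - S.Xm) * expI S.X (-t)))) t := by
  have h1 : HasDerivAt (fun s => (S.Wm s) S.Ω)
      ((Complex.I • (expI S.Ym t * (S.Ym - S.Xm) * expI S.Xm (-t))) S.Ω) t :=
    ((ContinuousLinearMap.apply ℂ H S.Ω).restrictScalars ℝ).hasFDerivAt.comp_hasDerivAt t
      (hasDerivAt_expI_mul_expI_neg S.Ym S.Xm t)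
  have h2 : HasDerivAt (fun s => mean S.Ω (S.Wm s))
      (inner ℂ S.Ω ((Complex.I • (expI S.Ym t * (S.Ym - S.Xm) * expI S.Xm (-t))) S.Ω)) t :=
    ((innerSL ℂ S.Ω).restrictScalars ℝ).hasFDerivAt.comp_hasDerivAt t h1
  refine h2.congr_deriv ?_
  rw [← S.expI_X_conj (sub_mem S.Ym_mem S.Xm_mem), Wm, smul_apply, inner_smul_right, mean]
  have h3 : expI S.Ym t * expI S.Xm (-t) *
      (expI S.Xm t * (S.Ym - S.Xm) * expI S.Xm (-t)) =
      expI S.Ym t * (expI S.Xm (-t) * expI S.Xm t) * (S.Ym - S.Xm) * expI S.Xm (-t) := by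
    simp only [mul_assoc]
  rw [h3, expI_neg_mul_expI S.sa_Xm, mul_one]

/-- The curve `⟨Ω, W₋ t Ω⟩` nearly rotates with the frequency `⟨Ω, T₋ Ω⟩`. -/
lemma norm_deriv_mean_Wm_sub_le {t : ℝ} (ht : t ∈ Set.Icc 0 (2 * Real.pi)) :
    ‖Complex.I * mean S.Ω (S.Wm t * (expI S.X t * (S.Ym - S.Xm) * expI S.X (-t))) -
      Complex.I * mean S.Ω S.Tm * mean S.Ω (S.Wm t)‖ ≤ 115 * (S.N + 1) * √S.ε := by
  set D := S.Ym - S.Xm with hD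
  set B := expI S.X t * D * expI S.X (-t) with hB
  set w := mean S.Ω (S.Wm t) with hw
  have h7 := abs_le_seven ht
  have hε := S.ε_nonneg
  have hN := S.N_nonneg
  have hs : S.ε ≤ √S.ε := Real.le_sqrt_of_sq_le (by nlinarith [S.ε_le_one])
  have hBn : ‖B‖ ≤ 3 * S.N := by
    rw [hB, CStarRing.norm_mul_mem_unitary _ (expI_mem_unitary S.sa_X _),
      CStarRing.norm_mem_unitary_mul _ (expI_mem_unitary S.sa_X _)]
    exact S.norm_D_le
  have hWs : ‖star (S.Wm t) S.Ω - starRingEnd ℂ w • S.Ω‖ ≤ 9 * √S.ε := by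
    have h1 := norm_star_apply_sub_mean_sq S.norm_Ω (S.Wm_unitary t)
    have h2 := S.one_sub_norm_mean_Wm_sq_le ht
    rw [← h1] at h2
    refine le_of_sq_le_sq ?_ (by positivity)
    rw [mul_pow, Real.sq_sqrt hε]
    linarith
  have hwn : ‖w‖ ≤ 1 :=
    (norm_mean_le S.norm_Ω _).trans (norm_le_one_of_mem_unitary (S.Wm_unitary t))
  -- `Ω` is an approximate eigenvector of `W₋*`, so the expectation factorizes
  have e1 : ‖mean S.Ω (S.Wm t * B) - w * mean S.Ω B‖ ≤ 9 * √S.ε * (3 * S.N) := by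
    have : mean S.Ω (S.Wm t * B) - w * mean S.Ω B =
        inner ℂ (star (S.Wm t) S.Ω - starRingEnd ℂ w • S.Ω) (B S.Ω) := by
      rw [inner_sub_left, inner_smul_left, Complex.conj_conj, ContinuousLinearMap.star_eq_adjoint,
        ContinuousLinearMap.adjoint_inner_left]
      rfl
    rw [this]
    refine (norm_inner_le_norm _ _).trans (mul_le_mul hWs ?_ (norm_nonneg _) (by positivity))
    refine (B.le_opNorm _).trans ?_
    rwa [S.norm_Ω, mul_one]
  -- `Ω` is an approximate eigenvector of `X`, so its expectations are invariant
  have e2 : ‖mean S.Ω B - mean S.Ω D‖ ≤ 4 * (7 * S.ε) * (3 * S.N) := by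
    have h1 := S.norm_expI_X_apply (-t)
    have h2 : ‖expI S.X (-t) S.Ω - Complex.exp (((-t : ℝ) : ℂ) * S.κ * Complex.I) • S.Ω‖ ≤
        7 * S.ε := by
      refine h1.trans ?_
      rw [abs_neg, mul_comm]
      exact mul_le_mul_of_nonneg_right h7 hε
    have h3 := norm_inner_sub_mean_le (a := expI S.X (-t) S.Ω) (Ω := S.Ω)
      (by rw [ContinuousLinearMap.norm_map_of_mem_unitary (expI_mem_unitary S.sa_X _), S.norm_Ω])
      S.norm_Ω (norm_cexp_mul_I _ _).le h2 D
    have h4 : mean S.Ω B = inner ℂ (expI S.X (-t) S.Ω) (D (expI S.X (-t) S.Ω)) := by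
      conv_rhs => rw [← star_expI S.sa_X, ContinuousLinearMap.star_eq_adjoint,
        ContinuousLinearMap.adjoint_inner_left, ← ContinuousLinearMap.star_eq_adjoint,
        star_expI S.sa_X]
      rfl
    rw [h4]
    exact h3.trans (mul_le_mul_of_nonneg_left S.norm_D_le (by positivity))
  have e3 := S.norm_mean_D_sub_le
  rw [← hD] at e3
  have h5 : Complex.I * mean S.Ω (S.Wm t * B) - Complex.I * mean S.Ω S.Tm * w =
      Complex.I * ((mean S.Ω (S.Wm t * B) - w * mean S.Ω B) +
        w * (mean S.Ω B - mean S.Ω D) + w * (mean S.Ω D - mean S.Ω S.Tm)) := by ring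
  rw [h5, norm_mul, Complex.norm_I, one_mul]
  refine norm_add₃_le.trans ?_
  rw [norm_mul, norm_mul]
  have e2' := mul_le_of_le_one_left (norm_nonneg (mean S.Ω B - mean S.Ω D)) hwn
  have e3' := mul_le_of_le_one_left (norm_nonneg (mean S.Ω D - mean S.Ω S.Tm)) hwn
  have hsN : S.ε * S.N ≤ √S.ε * S.N := mul_le_mul_of_nonneg_right hs hN
  nlinarith [Real.sqrt_nonneg S.ε]

/-- The splitting constraint, transported by `U`: the total charge of the second strip is
integral. -/
lemma norm_expI_Qp_add_Tp_sub_one_le : ‖expI (S.Qp + S.Tp) (2 * Real.pi) - 1‖ ≤ 8 * S.ε := by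
  set Z := expI (S.Qp + S.Tp) (2 * Real.pi) with hZ
  set Z' := expI (S.Qm + S.Tm) (2 * Real.pi) with hZ'
  have hm : S.Qm + S.Tm ∈ S.M := add_mem S.Qm_mem S.Tm_mem
  have hp : S.Qp + S.Tp ∈ S.P := add_mem S.Qp_mem S.Tp_mem
  have h0 : expI (S.Q₀ + S.Qm + S.Qp) (2 * Real.pi) = 1 := by
    rw [add_assoc, S.expI_split S.Qm_mem S.Qp_mem, S.exp_Q₀, S.exp_Qm, S.exp_Qp, one_mul, one_mul]
  have h1 : expI (S.Q₀ + S.Qm + S.Qp + S.Tm) (2 * Real.pi) = Z' := by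
    rw [show S.Q₀ + S.Qm + S.Qp + S.Tm = S.Q₀ + ((S.Qm + S.Tm) + S.Qp) by abel,
      S.expI_split hm S.Qp_mem, S.exp_Q₀, S.exp_Qp, one_mul, mul_one]
  have h2 := S.splitting
  rw [h1] at h2
  have sm := S.sa_Qm.add S.sa_Tm
  have sp := S.sa_Qp.add S.sa_Tp
  have h3 := norm_expI_sub_expI_le (t := 2 * Real.pi)
    (isSelfAdjoint_conj ((S.sa_Q₀.add S.sa_Qm).add S.sa_Qp) S.U)
    (S.sa_Q₀.add (sm.add sp))
  rw [expI_conj S.U_mem, h0, mul_one, Unitary.star_mul_self_of_mem S.U_mem,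
    S.expI_split hm hp, S.exp_Q₀, one_mul, ← hZ, ← hZ'] at h3
  have h4 : star S.U * (S.Q₀ + S.Qm + S.Qp) * S.U - (S.Q₀ + (S.Qm + S.Tm + (S.Qp + S.Tp))) =
      star S.U * (S.Q₀ + S.Qm + S.Qp) * S.U - (S.Q₀ + S.Qm + S.Qp) - S.Tm - S.Tp := by abel
  rw [h4] at h3
  -- the conjugated total charge is integral, so `Z' * Z` is close to `1`
  have h5 : Z - 1 = -((Z' - 1) * Z) + -(1 - Z' * Z) := by noncomm_ring
  have h7 := abs_le_seven (t := 2 * Real.pi) ⟨by positivity, le_rfl⟩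
  rw [h5]
  refine (norm_add_le _ _).trans ?_
  rw [norm_neg, norm_neg, CStarRing.norm_mul_mem_unitary _ (expI_mem_unitary sp _)]
  have h8 := mul_le_mul S.transport h7 (abs_nonneg _) S.ε_nonneg
  linarith

/-- Over a full period the transported half `Y₋` of the corrected charge generates the same
unitary as `U* X₋ U`. -/
lemma norm_expI_Ym_sub_le :
    ‖expI S.Ym (2 * Real.pi) - star S.U * expI S.Xm (2 * Real.pi) * S.U‖ ≤ 22 * S.ε := by
  set Z := expI (S.Qp + S.Tp) (2 * Real.pi) with hZ
  have hp : S.Qp + S.Tp ∈ S.P := add_mem S.Qp_mem S.Tp_mem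
  have sp := S.sa_Qp.add S.sa_Tp
  have h3 := norm_expI_sub_expI_le (t := 2 * Real.pi)
    (isSelfAdjoint_conj (S.sa_Q₀.add (S.sa_Xm.add S.sa_Qp)) S.U)
    (S.sa_Q₀.add (S.sa_Ym.add sp))
  rw [expI_conj S.U_mem, S.expI_split S.Xm_mem S.Qp_mem, S.expI_split S.Ym_mem hp, S.exp_Q₀,
    S.exp_Qp, one_mul, one_mul, mul_one, ← hZ] at h3
  have h4 : star S.U * (S.Q₀ + (S.Xm + S.Qp)) * S.U - (S.Q₀ + (S.Ym + (S.Qp + S.Tp))) =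
      (star S.U * (S.Q₀ + S.Qm + S.Qp) * S.U - (S.Q₀ + S.Qm + S.Qp) - S.Tm - S.Tp) -
      (star S.U * S.Km * S.U - S.Rm) := by
    simp only [Xm, Ym]; noncomm_ring
  have h5 : ‖star S.U * (S.Q₀ + (S.Xm + S.Qp)) * S.U -
      (S.Q₀ + (S.Ym + (S.Qp + S.Tp)))‖ ≤ 2 * S.ε := by
    rw [h4]
    refine (norm_sub_le _ _).trans ?_
    linarith [S.transport, S.approx_Km]
  have h6 : expI S.Ym (2 * Real.pi) - star S.U * expI S.Xm (2 * Real.pi) * S.U =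
      -(expI S.Ym (2 * Real.pi) * (Z - 1)) +
      -(star S.U * expI S.Xm (2 * Real.pi) * S.U - expI S.Ym (2 * Real.pi) * Z) := by
    noncomm_ring
  have h7 := abs_le_seven (t := 2 * Real.pi) ⟨by positivity, le_rfl⟩
  have hε := S.ε_nonneg
  rw [h6]
  refine (norm_add_le _ _).trans ?_
  rw [norm_neg, norm_neg, CStarRing.norm_mem_unitary_mul _ (expI_mem_unitary S.sa_Ym _)]
  have h8 := mul_le_mul h5 h7 (abs_nonneg _) (by positivity)
  linarith [S.norm_expI_Qp_add_Tp_sub_one_le]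

/-- The curve `⟨Ω, W₋ t Ω⟩` nearly closes after a full period. -/
lemma norm_mean_Wm_two_pi_sub_one_le :
    ‖mean S.Ω (S.Wm (2 * Real.pi)) - 1‖ ≤ 46 * √S.ε := by
  set V := expI S.Xm (2 * Real.pi) with hV
  set y := mean S.Ω V with hy
  have h7 := abs_le_seven (t := 2 * Real.pi) ⟨by positivity, le_rfl⟩
  have hε := S.ε_nonneg
  have hs : S.ε ≤ √S.ε := Real.le_sqrt_of_sq_le (by nlinarith [S.ε_le_one])
  have hVu : V ∈ unitary (H →L[ℂ] H) := expI_mem_unitary S.sa_Xm _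
  have hVu' : expI S.Xp (2 * Real.pi) ∈ unitary (H →L[ℂ] H) := expI_mem_unitary S.sa_Xp _
  have h1 := S.norm_expI_X_apply (2 * Real.pi)
  rw [X, S.expI_split S.Xm_mem S.Xp_mem, S.exp_Q₀, one_mul] at h1
  have h2 := one_sub_norm_mean_sq_le S.norm_Ω hVu hVu' (norm_cexp_mul_I _ _) h1
    (S.cluster_unitary (expI_mem S.isClosed_M S.Xm_mem _) (expI_mem S.isClosed_P S.Xp_mem _)
      hVu hVu')
  rw [← hy] at h2
  have h3 : 1 - ‖y‖ ^ 2 ≤ 16 * S.ε := by nlinarith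
  have hyn : ‖y‖ ≤ 1 := (norm_mean_le S.norm_Ω _).trans (norm_le_one_of_mem_unitary hVu)
  have hVs : ‖star V S.Ω - starRingEnd ℂ y • S.Ω‖ ≤ 4 * √S.ε := by
    have h4 := norm_star_apply_sub_mean_sq S.norm_Ω hVu
    rw [← hy] at h4
    rw [← h4] at h3
    refine le_of_sq_le_sq ?_ (by positivity)
    rw [mul_pow, Real.sq_sqrt hε]
    linarith
  have hU := norm_inner_sub_mean_le
    (by rw [ContinuousLinearMap.norm_map_of_mem_unitary S.U_mem, S.norm_Ω]) S.norm_Ω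
    S.norm_mean_U S.invariant V
  set G := star S.U * V * S.U with hG
  have hGu : G ∈ unitary (H →L[ℂ] H) :=
    mul_mem (mul_mem (Unitary.star_mem S.U_mem) hVu) S.U_mem
  have hUG : inner ℂ (S.U S.Ω) (V (S.U S.Ω)) = mean S.Ω G := by
    rw [hG, mean, mul_assoc, mul_apply_eq_comp, ContinuousLinearMap.star_eq_adjoint,
      ContinuousLinearMap.adjoint_inner_right, mul_apply_eq_comp]
  rw [hUG, ← hy] at hU
  have hU' : ‖mean S.Ω G - y‖ ≤ 4 * S.ε :=
    hU.trans (mul_le_of_le_one_right (by positivity) (norm_le_one_of_mem_unitary hVu))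
  have hYm : ‖mean S.Ω ((expI S.Ym (2 * Real.pi) - G) * star V)‖ ≤ 22 * S.ε := by
    refine (norm_mean_le S.norm_Ω _).trans ?_
    rw [CStarRing.norm_mul_mem_unitary _ (Unitary.star_mem hVu)]
    exact S.norm_expI_Ym_sub_le
  have hin : ‖inner ℂ S.Ω (G (star V S.Ω - starRingEnd ℂ y • S.Ω))‖ ≤ 4 * √S.ε := by
    refine (norm_inner_le_norm _ _).trans ?_
    rwa [S.norm_Ω, one_mul, ContinuousLinearMap.norm_map_of_mem_unitary hGu]
  have hy2 : ‖((‖y‖ ^ 2 - 1 : ℝ) : ℂ)‖ ≤ 16 * S.ε := by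
    rw [Complex.norm_real, Real.norm_eq_abs, abs_sub_comm, abs_of_nonneg]
    · exact h3
    · nlinarith [norm_nonneg y]
  have hyU : ‖starRingEnd ℂ y * (mean S.Ω G - y)‖ ≤ 4 * S.ε := by
    rw [norm_mul, RCLike.norm_conj]
    exact (mul_le_of_le_one_left (norm_nonneg _) hyn).trans hU'
  have h8 : mean S.Ω (S.Wm (2 * Real.pi)) - 1 =
      mean S.Ω ((expI S.Ym (2 * Real.pi) - G) * star V) +
      inner ℂ S.Ω (G (star V S.Ω - starRingEnd ℂ y • S.Ω)) +
      starRingEnd ℂ y * (mean S.Ω G - y) + ((‖y‖ ^ 2 - 1 : ℝ) : ℂ) := by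
    have h6 : ((‖y‖ ^ 2 : ℝ) : ℂ) = starRingEnd ℂ y * y := by
      rw [← Complex.normSq_eq_norm_sq, Complex.normSq_eq_conj_mul_self]
    rw [Complex.ofReal_sub, h6, Wm, ← star_expI S.sa_Xm, ← hV]
    simp only [mean, mul_apply_eq_comp, sub_apply, map_sub, map_smul, inner_sub_right,
      inner_smul_right, Complex.ofReal_one]
    ring
  rw [h8]
  refine (norm_add_le _ _).trans ?_
  have := norm_add₃_le (a := mean S.Ω ((expI S.Ym (2 * Real.pi) - G) * star V))
    (b := inner ℂ S.Ω (G (star V S.Ω - starRingEnd ℂ y • S.Ω)))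
    (c := starRingEnd ℂ y * (mean S.Ω G - y))
  linarith

/-- The expectation of the charge transported in the first strip is nearly an integer. -/
theorem norm_exp_mean_Tm_sub_one_le :
    ‖Complex.exp (2 * Real.pi * Complex.I * mean S.Ω S.Tm) - 1‖ ≤ 851 * ((S.N + 1) * √S.ε) := by
  set τ := (mean S.Ω S.Tm).re with hτ
  have hτ' : (τ : ℂ) = mean S.Ω S.Tm := by
    rw [hτ, ← Complex.conj_eq_iff_re, ← mean_star, S.sa_Tm.star_eq]
  have h0 : mean S.Ω (S.Wm 0) = 1 := by
    simp [Wm, expI_zero, mean, S.norm_Ω]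
  have h1 := norm_sub_exp_le S.hasDerivAt_mean_Wm h0 (τ := τ) (T := 2 * Real.pi) (by positivity)
    (fun t ht => by rw [hτ']; exact S.norm_deriv_mean_Wm_sub_le ht)
  have h2 := S.norm_mean_Wm_two_pi_sub_one_le
  have h3 : Complex.exp (2 * Real.pi * Complex.I * mean S.Ω S.Tm) - 1 =
      (mean S.Ω (S.Wm (2 * Real.pi)) - 1) - (mean S.Ω (S.Wm (2 * Real.pi)) -
        Complex.exp (((2 * Real.pi : ℝ) : ℂ) * τ * Complex.I)) := by
    rw [hτ']; push_cast; ring_nf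
  rw [h3]
  refine (norm_sub_le _ _).trans ?_
  have hN := S.N_nonneg
  have hb : 0 ≤ 115 * (S.N + 1) * √S.ε := by positivity
  have hpi : 2 * Real.pi ≤ 7 := by linarith [Real.pi_lt_d2]
  have h4 := mul_le_mul_of_nonneg_left hpi hb
  have h5 : 0 ≤ S.N * √S.ε := by positivity
  linarith

end SplitModel

/-! ### Locality of the algebras of observables -/

section SpinLocality

variable {V W Z S : Type*} [Fintype V] [Fintype W] [Fintype Z] [Fintype S]
  [DecidableEq V] [DecidableEq W] [DecidableEq Z] [DecidableEq S]

open Classical in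
/-- The matrix of a product of operators acting on disjoint sets of sites, in a form which is
symmetric in the two factors. -/
lemma tensorOne_mul_tensorOne_apply (e : V ↪ Z) (f : W ↪ Z) (hef : ∀ v w, e v ≠ f w)
    (A : Op V S) (B : Op W S) (η ζ : Conf Z S) :
    (tensorOne e A * tensorOne f B) η ζ =
      if ∀ z, z ∉ Set.range e → z ∉ Set.range f → η z = ζ z then
        A (η ∘ e) (ζ ∘ e) * B (η ∘ f) (ζ ∘ f) else 0 := by
  change ∑ ξ, tensorOneFun e A η ξ * tensorOneFun f B ξ ζ = _
  simp only [tensorOneFun, Matrix.of_apply]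
  have hf : glue e η (ζ ∘ e) ∘ f = η ∘ f := funext fun w =>
    glue_off e η _ fun ⟨v, hv⟩ => hef v w hv
  rw [Finset.sum_eq_single (glue e η (ζ ∘ e))]
  · rw [if_pos (agreeOff_glue e η _), glue_comp, hf]
    have h : AgreeOff f (glue e η (ζ ∘ e)) ζ ↔
        ∀ z, z ∉ Set.range e → z ∉ Set.range f → η z = ζ z := by
      constructor
      · intro h z h1 h2
        rw [← h z h2, glue_off e η _ h1]
      · intro h z h2
        by_cases h1 : z ∈ Set.range e
        · obtain ⟨v, rfl⟩ := h1
          rw [glue_apply]; rfl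
        · rw [glue_off e η _ h1, h z h1 h2]
    simp only [h, mul_ite, mul_zero]
  · intro ξ _ hξ
    by_cases h1 : AgreeOff e η ξ
    · by_cases h2 : AgreeOff f ξ ζ
      · refine absurd ?_ hξ
        have h3 : ξ ∘ e = ζ ∘ e := funext fun v => h2 _ fun ⟨w, hw⟩ => hef v w hw.symm
        rw [← h3, h1.eq_glue]
      · simp [h2]
    · simp [h1]
  · intro h
    exact absurd (Finset.mem_univ _) h

lemma commute_tensorOne (e : V ↪ Z) (f : W ↪ Z) (hef : ∀ v w, e v ≠ f w)
    (A : Op V S) (B : Op W S) : Commute (tensorOne e A) (tensorOne f B) := by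
  ext η ζ
  rw [tensorOne_mul_tensorOne_apply e f hef,
    tensorOne_mul_tensorOne_apply f e (fun w v => (hef v w).symm)]
  have h : (∀ z, z ∉ Set.range e → z ∉ Set.range f → η z = ζ z) ↔
      (∀ z, z ∉ Set.range f → z ∉ Set.range e → η z = ζ z) :=
    ⟨fun h z h1 h2 => h z h2 h1, fun h z h1 h2 => h z h2 h1⟩
  simp only [h, mul_comm]

end SpinLocality

section FermionLocality

variable {d ℓ n : ℕ}

/-- The configuration `ζ` with the occupation of the mode `(x, σ)` set to `b`. -/
def setMode (x : Torus d ℓ) (σ : Fin n) (b : Bool) (ζ : Conf (Torus d ℓ) (Fin n → Bool)) :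
    Conf (Torus d ℓ) (Fin n → Bool) :=
  Function.update ζ x (Function.update (ζ x) σ b)

lemma setMode_same (x : Torus d ℓ) (σ : Fin n) (b : Bool)
    (ζ : Conf (Torus d ℓ) (Fin n → Bool)) : setMode x σ b ζ x σ = b := by
  simp [setMode]

lemma setMode_of_ne {x y : Torus d ℓ} {σ τ : Fin n} (h : (y, τ) ≠ (x, σ)) (b : Bool)
    (ζ : Conf (Torus d ℓ) (Fin n → Bool)) : setMode x σ b ζ y τ = ζ y τ := by
  by_cases hy : y = x
  · subst hy
    have : τ ≠ σ := fun h' => h (by rw [h'])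
    simp [setMode, this]
  · simp [setMode, hy]

lemma setMode_setMode (x : Torus d ℓ) (σ : Fin n) (b c : Bool)
    (ζ : Conf (Torus d ℓ) (Fin n → Bool)) :
    setMode x σ b (setMode x σ c ζ) = setMode x σ b ζ := by
  simp [setMode]

lemma setMode_eq_self {x : Torus d ℓ} {σ : Fin n} {b : Bool}
    {ζ : Conf (Torus d ℓ) (Fin n → Bool)} (h : ζ x σ = b) : setMode x σ b ζ = ζ := by
  simp [setMode, ← h]

lemma setMode_comm {x y : Torus d ℓ} (h : x ≠ y) (σ τ : Fin n) (b c : Bool)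
    (ζ : Conf (Torus d ℓ) (Fin n → Bool)) :
    setMode x σ b (setMode y τ c ζ) = setMode y τ c (setMode x σ b ζ) := by
  simp only [setMode, Function.update_of_ne h, Function.update_of_ne h.symm]
  exact Function.update_comm h.symm _ _ _

lemma modeKey_ne {x y : Torus d ℓ} (h : x ≠ y) (σ τ : Fin n) : modeKey x σ ≠ modeKey y τ := by
  intro h'
  refine h (funext fun i => Subtype.ext ?_)
  have h1 : coords x = coords y := by
    simp only [modeKey, EmbeddingLike.apply_eq_iff_eq, Prod.mk.injEq] at h'
    exact h'.2.1
  exact congrFun h1 i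

lemma occBefore_setMode_of_not_lt {x y : Torus d ℓ} {σ τ : Fin n}
    (h : ¬ modeKey y τ < modeKey x σ) (b : Bool) (ζ : Conf (Torus d ℓ) (Fin n → Bool)) :
    occBefore x σ (setMode y τ b ζ) = occBefore x σ ζ := by
  classical
  refine congrArg Finset.card (Finset.filter_congr fun p _ => and_congr_right fun hp => ?_)
  rw [setMode_of_ne]
  rintro h'
  obtain ⟨rfl, rfl⟩ := Prod.mk.inj h'
  exact h hp

lemma occBefore_setMode_true {x y : Torus d ℓ} {σ τ : Fin n}
    (h : modeKey y τ < modeKey x σ) {ζ : Conf (Torus d ℓ) (Fin n → Bool)} (hζ : ζ y τ = false) :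
    occBefore x σ (setMode y τ true ζ) = occBefore x σ ζ + 1 := by
  classical
  rw [occBefore, occBefore, ← Finset.card_insert_of_notMem (a := (y, τ)) (by simp [hζ])]
  congr 1
  ext p
  simp only [Finset.mem_filter, Finset.mem_univ, true_and, Finset.mem_insert]
  by_cases hp : p = (y, τ)
  · subst hp
    simp [h, setMode_same]
  · rw [setMode_of_ne hp]
    simp [hp]

/-- Flipping a preceding mode changes the sign attached to a mode. -/
lemma neg_one_pow_occBefore_setMode {x y : Torus d ℓ} {σ τ : Fin n}
    (h : modeKey y τ < modeKey x σ) {b : Bool} {ζ : Conf (Torus d ℓ) (Fin n → Bool)}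
    (hζ : ζ y τ = !b) :
    (-1 : ℂ) ^ occBefore x σ (setMode y τ b ζ) = -(-1) ^ occBefore x σ ζ := by
  cases b with
  | true => rw [occBefore_setMode_true h hζ, pow_succ]; ring
  | false =>
    have h1 := occBefore_setMode_true h (setMode_same y τ false ζ)
    rw [setMode_setMode, setMode_eq_self (b := true) hζ] at h1
    rw [h1, pow_succ]; ring

open Classical in
/-- The annihilation operator (`b = false`) and the creation operator (`b = true`) of a mode. -/
noncomputable def ladder (x : Torus d ℓ) (σ : Fin n) (b : Bool) :
    Op (Torus d ℓ) (Fin n → Bool) :=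
  Matrix.of fun η ζ =>
    if ζ x σ = (!b) ∧ η = setMode x σ b ζ then (-1) ^ occBefore x σ ζ else 0

lemma annihilate_eq_ladder (x : Torus d ℓ) (σ : Fin n) : annihilate x σ = ladder x σ false := rfl

lemma star_annihilate_eq_ladder (x : Torus d ℓ) (σ : Fin n) :
    star (annihilate x σ) = ladder x σ true := by
  classical
  ext η ζ
  rw [annihilate_eq_ladder, Matrix.star_apply]
  simp only [ladder, Matrix.of_apply, Bool.not_false, Bool.not_true]
  have h : (η x σ = true ∧ ζ = setMode x σ false η) ↔
      (ζ x σ = false ∧ η = setMode x σ true ζ) := by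
    constructor
    · rintro ⟨h1, rfl⟩
      exact ⟨setMode_same .., by rw [setMode_setMode, setMode_eq_self h1]⟩
    · rintro ⟨h1, rfl⟩
      exact ⟨setMode_same .., by rw [setMode_setMode, setMode_eq_self h1]⟩
  by_cases h1 : ζ x σ = false ∧ η = setMode x σ true ζ
  · rw [if_pos h1, if_pos (h.2 h1), (h.2 h1).2, occBefore_setMode_of_not_lt (lt_irrefl _)]
    simp
  · rw [if_neg h1, if_neg (mt h.1 h1), star_zero]

open Classical in
lemma ladder_mul_ladder_apply {x y : Torus d ℓ} (hxy : x ≠ y) (σ τ : Fin n) (b c : Bool)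
    (η ζ : Conf (Torus d ℓ) (Fin n → Bool)) :
    (ladder x σ b * ladder y τ c) η ζ =
      if ζ x σ = (!b) ∧ ζ y τ = (!c) ∧ η = setMode x σ b (setMode y τ c ζ) then
        (-1) ^ occBefore x σ (setMode y τ c ζ) * (-1) ^ occBefore y τ ζ else 0 := by
  rw [Matrix.mul_apply, Finset.sum_eq_single (setMode y τ c ζ)]
  · simp only [ladder, Matrix.of_apply]
    rw [setMode_of_ne (by simp [hxy])]
    by_cases h1 : ζ x σ = (!b) <;> by_cases h2 : ζ y τ = (!c) <;> simp [h1, h2]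
  · intro ξ _ hξ
    simp [ladder, hξ]
  · intro h
    exact absurd (Finset.mem_univ _) h

/-- The anticommutation relations at different sites: the operator of the earlier mode changes the
sign of the later one, and not conversely. -/
lemma ladder_anticomm {x y : Torus d ℓ} (hxy : x ≠ y) (σ τ : Fin n) (b c : Bool) :
    ladder x σ b * ladder y τ c = -(ladder y τ c * ladder x σ b) := by
  wlog h : modeKey x σ < modeKey y τ generalizing x y σ τ b c
  · have h' : modeKey y τ < modeKey x σ := lt_of_le_of_ne (not_lt.1 h) (modeKey_ne hxy.symm τ σ)
    rw [this hxy.symm τ σ c b h', neg_neg]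
  ext η ζ
  rw [Matrix.neg_apply, ladder_mul_ladder_apply hxy, ladder_mul_ladder_apply hxy.symm,
    setMode_comm hxy, occBefore_setMode_of_not_lt h.not_gt]
  by_cases h1 : ζ x σ = (!b)
  · rw [neg_one_pow_occBefore_setMode h h1]
    by_cases h2 : ζ y τ = (!c) ∧ η = setMode y τ c (setMode x σ b ζ)
    · rw [if_pos ⟨h1, h2⟩, if_pos ⟨h2.1, h1, h2.2⟩]; ring
    · rw [if_neg fun h3 => h2 h3.2, if_neg fun h3 => h2 ⟨h3.1, h3.2.2⟩, neg_zero]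
  · rw [if_neg fun h3 => h1 h3.1, if_neg fun h3 => h1 h3.2.1, neg_zero]

lemma exists_ladder_of_mem_fermiGenerators {X : Finset (Torus d ℓ)}
    {a : Op (Torus d ℓ) (Fin n → Bool)} (ha : a ∈ fermiGenerators n X) :
    ∃ x ∈ X, ∃ (σ : Fin n) (b : Bool), a = ladder x σ b := by
  obtain ⟨x, hx, σ, rfl | rfl⟩ := ha
  · exact ⟨x, hx, σ, false, annihilate_eq_ladder x σ⟩
  · exact ⟨x, hx, σ, true, star_annihilate_eq_ladder x σ⟩

lemma fermiGenerators_anticomm {X Y : Finset (Torus d ℓ)} (hXY : Disjoint X Y)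
    {a b : Op (Torus d ℓ) (Fin n → Bool)} (ha : a ∈ fermiGenerators n X)
    (hb : b ∈ fermiGenerators n Y) : a * b = -(b * a) := by
  obtain ⟨x, hx, σ, s, rfl⟩ := exists_ladder_of_mem_fermiGenerators ha
  obtain ⟨y, hy, τ, t, rfl⟩ := exists_ladder_of_mem_fermiGenerators hb
  exact ladder_anticomm (fun h => Finset.disjoint_left.1 hXY hx (by rwa [h])) σ τ s t

lemma star_mem_fermiGenerators {X : Finset (Torus d ℓ)} {a : Op (Torus d ℓ) (Fin n → Bool)}
    (ha : a ∈ fermiGenerators n X) : star a ∈ fermiGenerators n X := by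
  obtain ⟨x, hx, σ, rfl | rfl⟩ := ha
  · exact ⟨x, hx, σ, Or.inr rfl⟩
  · exact ⟨x, hx, σ, Or.inl (star_star _)⟩

lemma commute_of_mem_adjoin {A : Type*} [Ring A] [StarRing A] [Algebra ℂ A] [StarModule ℂ A]
    {s t : Set A} (ht : ∀ b ∈ t, star b ∈ t)
    (hst : ∀ a ∈ s, ∀ b ∈ t, a * b = b * a) {a b : A} (ha : a ∈ StarAlgebra.adjoin ℂ s)
    (hb : b ∈ StarAlgebra.adjoin ℂ t) : Commute a b := by
  have h1 : StarAlgebra.adjoin ℂ s ≤ StarSubalgebra.centralizer ℂ t :=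
    StarAlgebra.adjoin_le fun x hx => (StarSubalgebra.mem_centralizer_iff ℂ).2 fun g hg =>
      ⟨(hst x hx g hg).symm, (hst x hx _ (ht g hg)).symm⟩
  have h2 : StarAlgebra.adjoin ℂ t ≤
      StarSubalgebra.centralizer ℂ (StarAlgebra.adjoin ℂ s : Set A) :=
    StarAlgebra.adjoin_le fun y hy => (StarSubalgebra.mem_centralizer_iff ℂ).2 fun g hg =>
      ⟨(((StarSubalgebra.mem_centralizer_iff ℂ).1 (h1 hg)) y hy).1.symm,
        (((StarSubalgebra.mem_centralizer_iff ℂ).1 (h1 (star_mem hg))) y hy).1.symm⟩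
  exact ((StarSubalgebra.mem_centralizer_iff ℂ).1 (h2 hb) a ha).1

lemma evenAlgebra_commute {X Y : Finset (Torus d ℓ)} (hXY : Disjoint X Y)
    {A B : Op (Torus d ℓ) (Fin n → Bool)} (hA : A ∈ evenAlgebra n X) (hB : B ∈ evenAlgebra n Y) :
    Commute A B := by
  have hstar : ∀ g ∈ {A | ∃ a ∈ fermiGenerators n Y,
      ∃ b ∈ fermiGenerators n Y, A = a * b}, star g ∈ {A | ∃ a ∈ fermiGenerators n Y,
      ∃ b ∈ fermiGenerators n Y, A = a * b} := by
    rintro _ ⟨a, ha, b, hb, rfl⟩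
    exact ⟨_, star_mem_fermiGenerators hb, _, star_mem_fermiGenerators ha, star_mul a b⟩
  refine commute_of_mem_adjoin hstar ?_ hA hB
  rintro _ ⟨a, ha, b, hb, rfl⟩ _ ⟨a', ha', b', hb', rfl⟩
  have h := fun {u v} hu hv => fermiGenerators_anticomm (n := n) hXY (a := u) (b := v) hu hv
  -- moving each of the two generators on the right past the two on the left costs two signs
  have h1 : Commute (a * b) a' := by
    rw [Commute, SemiconjBy, mul_assoc, h hb ha', mul_neg, ← mul_assoc, h ha ha', neg_mul,
      neg_neg, mul_assoc]
  have h2 : Commute (a * b) b' := by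
    rw [Commute, SemiconjBy, mul_assoc, h hb hb', mul_neg, ← mul_assoc, h ha hb', neg_mul,
      neg_neg, mul_assoc]
  exact (h1.mul_right h2).eq

lemma evenAlgebra_mono {X Y : Finset (Torus d ℓ)} (h : X ⊆ Y) :
    evenAlgebra n X ≤ evenAlgebra n Y := by
  refine StarAlgebra.adjoin_mono ?_
  rintro _ ⟨a, ⟨x, hx, ha⟩, b, ⟨y, hy, hb⟩, rfl⟩
  exact ⟨a, ⟨x, h hx, ha⟩, b, ⟨y, h hy, hb⟩, rfl⟩

end FermionLocality

lemma localAlg_mono (k : Kind) {d ℓ : ℕ} {X Y : Finset (Torus d ℓ)} (h : X ⊆ Y) :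
    localAlg k X ≤ localAlg k Y := by
  match k with
  | .spin n =>
    rintro _ ⟨A, rfl⟩
    exact ⟨tensorOne (S := Fin n) ⟨fun x : {x // x ∈ X} => (⟨x, h x.2⟩ : {x // x ∈ Y}),
      fun _ _ hxy => Subtype.ext (congrArg (fun z : {x // x ∈ Y} => (z : Torus d ℓ)) hxy)⟩ A,
      tensorOne_tensorOne _ _ _ (fun _ => rfl) A⟩
  | .fermion n => exact evenAlgebra_mono h

lemma localAlg_commute (k : Kind) {d ℓ : ℕ} {X Y : Finset (Torus d ℓ)} (h : Disjoint X Y)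
    {A B : FullOp k d ℓ} (hA : A ∈ localAlg k X) (hB : B ∈ localAlg k Y) : Commute A B := by
  match k with
  | .spin n =>
    obtain ⟨A, rfl⟩ := hA
    obtain ⟨B, rfl⟩ := hB
    exact commute_tensorOne (S := Fin n) _ _
      (fun v w hvw => Finset.disjoint_left.1 h v.2 (by
        have : (v : Torus d ℓ) = w := hvw
        rw [this]; exact w.2)) A B
  | .fermion n => exact evenAlgebra_commute h hA hB

/-! ### Integrality of sums of local charges -/

lemma expI_two_pi_of_spectrum {H : Type*} [NormedAddCommGroup H] [InnerProductSpace ℂ H]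
    [CompleteSpace H] {A : H →L[ℂ] H} (hA : IsSelfAdjoint A)
    (hs : spectrum ℂ A ⊆ Set.range (fun m : ℤ => (m : ℂ))) : expI A (2 * Real.pi) = 1 := by
  have hn : IsStarNormal A := hA.isStarNormal
  set c : ℂ := ((2 * Real.pi : ℝ) : ℂ) * Complex.I with hc
  have h1 : expI A (2 * Real.pi) = NormedSpace.exp (c • A) := by rw [expI, smul_smul]
  rw [h1, ← CFC.exp_eq_normedSpace_exp (𝕜 := ℂ) (a := c • A) (hn.smul c), ← cfc_comp_smul c _ A]
  have h2 : Set.EqOn (fun x : ℂ => NormedSpace.exp (c • x)) (fun _ => 1) (spectrum ℂ A) := by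
    intro x hx
    obtain ⟨m, rfl⟩ := hs hx
    simp only [← Complex.exp_eq_exp_ℂ]
    rw [Complex.exp_eq_one_iff]
    exact ⟨m, by rw [hc, smul_eq_mul]; push_cast; ring⟩
  rw [cfc_congr h2, cfc_const_one ℂ A]

lemma expI_sum_eq_one {H ι : Type*} [NormedAddCommGroup H] [InnerProductSpace ℂ H]
    [CompleteSpace H] {t : ℝ} (s : Finset ι) {f : ι → H →L[ℂ] H}
    (hf : ∀ i j, Commute (f i) (f j)) (h1 : ∀ i, expI (f i) t = 1) :
    expI (∑ i ∈ s, f i) t = 1 := by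
  classical
  induction s using Finset.induction_on with
  | empty => simp [expI]
  | insert i s hi ih =>
    rw [Finset.sum_insert hi, expI_add (Commute.sum_right _ _ _ fun j _ => hf i j), h1, ih,
      one_mul]

/-! ### Geometry of the strips -/

section Geometry

variable {d ℓ : ℕ}

lemma cyc_mem (x : Torus d ℓ) (i : Fin d) : -(ℓ : ℤ) < x i ∧ (x i : ℤ) ≤ ℓ :=
  Finset.mem_Ioc.1 (x i).2

lemma subset_fatten (X : Finset (Torus d ℓ)) {r : ℝ} (hr : 0 ≤ r) : X ⊆ fatten X r := by
  intro x hx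
  simp only [fatten, Finset.mem_filter, Finset.mem_univ, true_and]
  refine ⟨x, hx, ?_⟩
  simpa [torusDist, cycDist] using hr

lemma card_torus : Fintype.card (Torus d ℓ) = (2 * ℓ) ^ d := by
  simp only [Fintype.card_pi, Fintype.card_coe, Int.card_Ioc, Finset.prod_const,
    Finset.card_univ, Fintype.card_fin]
  congr 1
  omega

variable [NeZero d]

lemma cycDist_le_torusDist (x y : Torus d ℓ) : cycDist ℓ (x 0) (y 0) ≤ torusDist x y :=
  Finset.single_le_sum (f := fun i => cycDist ℓ (x i) (y i)) (fun _ _ => Nat.zero_le _)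
    (Finset.mem_univ 0)

lemma mem_stripMinus {x : Torus d ℓ} : x ∈ stripMinus d ℓ ↔ 8 * cycDist ℓ (x 0) 0 ≤ 2 * ℓ := by
  simp [stripMinus]

lemma mem_stripPlus {x : Torus d ℓ} : x ∈ stripPlus d ℓ ↔ 8 * cycDist ℓ (x 0) ℓ ≤ 2 * ℓ := by
  simp [stripPlus]

lemma disjoint_strips (hℓ : 1 ≤ ℓ) : Disjoint (stripMinus d ℓ) (stripPlus d ℓ) := by
  rw [Finset.disjoint_left]
  intro x hx hx'
  rw [mem_stripMinus] at hx
  rw [mem_stripPlus] at hx'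
  have := cyc_mem x 0
  unfold cycDist at hx hx'
  omega

/-- The strips are at distance at least `L / 4`. They are nonempty, so that `dist₁` is not the junk
value `sInf ∅ = 0`. -/
lemma le_two_mul_dist₁_strips (hℓ : 1 ≤ ℓ) :
    ℓ ≤ 2 * dist₁ (stripMinus d ℓ) (stripPlus d ℓ) := by
  have hne : {k | ∃ x ∈ stripMinus d ℓ, ∃ x' ∈ stripPlus d ℓ,
      k = cycDist ℓ (x 0) (x' 0)}.Nonempty := by
    refine ⟨_, fun _ => ⟨0, by rw [Finset.mem_Ioc]; omega⟩, mem_stripMinus.2 ?_,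
      fun _ => ⟨ℓ, by rw [Finset.mem_Ioc]; omega⟩, mem_stripPlus.2 ?_, rfl⟩ <;>
    · simp only [cycDist]; omega
  obtain ⟨x, hx, x', hx', h⟩ := Nat.sInf_mem hne
  rw [dist₁, h]
  rw [mem_stripMinus] at hx
  rw [mem_stripPlus] at hx'
  have h1 := cyc_mem x 0
  have h2 := cyc_mem x' 0
  unfold cycDist at *
  omega

lemma exists_of_mem_fatten_fatten {X : Finset (Torus d ℓ)} {x : Torus d ℓ}
    (hx : x ∈ fatten (fatten X ((2 * ℓ : ℝ) / 16)) ((ℓ / 16 : ℕ) : ℝ)) :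
    ∃ z ∈ X, 16 * cycDist ℓ (x 0) (z 0) ≤ 3 * ℓ := by
  simp only [fatten, Finset.mem_filter, Finset.mem_univ, true_and] at hx
  obtain ⟨y, ⟨z, hz, hyz⟩, hxy⟩ := hx
  refine ⟨z, hz, ?_⟩
  have h1 : torusDist x y ≤ ℓ / 16 := by exact_mod_cast hxy
  have h2 : 8 * torusDist y z ≤ ℓ := by
    have : (8 : ℝ) * torusDist y z ≤ ℓ := by linarith
    exact_mod_cast this
  have h3 := cycDist_le_torusDist x y
  have h4 := cycDist_le_torusDist y z
  have h5 := cyc_mem x 0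
  have h6 := cyc_mem y 0
  have h7 := cyc_mem z 0
  have h8 : cycDist ℓ (x 0) (z 0) ≤ cycDist ℓ (x 0) (y 0) + cycDist ℓ (y 0) (z 0) := by
    unfold cycDist; omega
  omega

lemma fatten_fatten_bdryMinus_subset :
    fatten (fatten (bdryMinus d ℓ) ((2 * ℓ : ℝ) / 16)) ((ℓ / 16 : ℕ) : ℝ) ⊆ stripMinus d ℓ := by
  intro x hx
  obtain ⟨z, hz, h⟩ := exists_of_mem_fatten_fatten hx
  simp only [bdryMinus, Finset.mem_filter, Finset.mem_univ, true_and] at hz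
  rw [mem_stripMinus]
  rw [hz] at h
  omega

/-- The boundary `x₁ = L/2 - 1` is off the centre `x₁ = L/2` of the strip by one, for which there is
room as soon as `16 ≤ ℓ`. -/
lemma fatten_fatten_bdryPlus_subset (hℓ : 16 ≤ ℓ) :
    fatten (fatten (bdryPlus d ℓ) ((2 * ℓ : ℝ) / 16)) ((ℓ / 16 : ℕ) : ℝ) ⊆ stripPlus d ℓ := by
  intro x hx
  obtain ⟨z, hz, h⟩ := exists_of_mem_fatten_fatten hx
  simp only [bdryPlus, Finset.mem_filter, Finset.mem_univ, true_and] at hz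
  rw [mem_stripPlus]
  rw [hz] at h
  have h5 := cyc_mem x 0
  unfold cycDist at *
  omega

end Geometry

/-! ### Superpolynomial decay -/

section Decay

open Asymptotics

lemma RapidDecay.superpolynomialDecay {f : ℕ → ℝ} (hf : RapidDecay f) :
    SuperpolynomialDecay atTop (fun N : ℕ => (N : ℝ)) f := by
  intro m
  have h1 : (fun N : ℕ => (N : ℝ) ^ m * f N) =O[atTop]
      fun N : ℕ => (N : ℝ) ^ m * ((N : ℝ) ^ (m + 1))⁻¹ := (isBigO_refl _ _).mul (hf (m + 1))
  refine h1.trans_tendsto ?_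
  refine (tendsto_inv_atTop_nhds_zero_nat (𝕜 := ℝ)).congr' ?_
  filter_upwards [eventually_gt_atTop 0] with N hN
  have : (N : ℝ) ≠ 0 := by positivity
  field_simp
  ring

lemma superpolynomialDecay_sqrt {f : ℕ → ℝ}
    (hf : SuperpolynomialDecay atTop (fun N : ℕ => (N : ℝ)) f) :
    SuperpolynomialDecay atTop (fun N : ℕ => (N : ℝ)) fun N => √(f N) := by
  intro m
  have h := (Real.continuous_sqrt.tendsto 0).comp (hf (m * 2))
  rw [Real.sqrt_zero] at h
  refine h.congr fun N => ?_
  rw [Function.comp_apply, Real.sqrt_mul (by positivity), pow_mul, Real.sqrt_sq (by positivity)]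

lemma superpolynomialDecay_comp_div {f : ℕ → ℝ}
    (hf : SuperpolynomialDecay atTop (fun N : ℕ => (N : ℝ)) f) {b : ℕ} (hb : 0 < b) :
    SuperpolynomialDecay atTop (fun N : ℕ => (N : ℝ)) fun N => f (N / b) := by
  intro m
  have h1 : Tendsto (fun N : ℕ => N / b) atTop atTop := Nat.tendsto_div_const_atTop hb.ne'
  have h2 := (((hf m).comp h1).abs.const_mul ((2 * b : ℝ) ^ m))
  rw [abs_zero, mul_zero] at h2
  refine squeeze_zero_norm' ?_ h2
  filter_upwards [eventually_ge_atTop b] with N hN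
  have h3 : (N : ℝ) ≤ 2 * b * (N / b : ℕ) := by
    have h4 : 1 ≤ N / b := (Nat.one_le_div_iff hb).2 hN
    have h5 := Nat.lt_div_mul_add (a := N) hb
    have : N ≤ 2 * b * (N / b) := by nlinarith
    exact_mod_cast this
  rw [Function.comp_apply, Real.norm_eq_abs, abs_mul, abs_mul, ← mul_assoc]
  refine mul_le_mul_of_nonneg_right ?_ (abs_nonneg _)
  rw [abs_of_nonneg (by positivity), abs_of_nonneg (by positivity), ← mul_pow]
  exact pow_le_pow_left₀ (by positivity) h3 m

lemma superpolynomialDecay_exp_neg {c : ℝ} (hc : 0 < c) :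
    SuperpolynomialDecay atTop (fun N : ℕ => (N : ℝ)) fun N => Real.exp (-c * N) := by
  intro m
  have h := (isLittleO_pow_exp_pos_mul_atTop m hc).tendsto_div_nhds_zero.comp
    (tendsto_natCast_atTop_atTop (R := ℝ))
  refine h.congr fun N => ?_
  dsimp only [Function.comp_apply]
  rw [neg_mul, Real.exp_neg, div_eq_mul_inv]

end Decay

/-! ### Finite tori -/

section Torus

variable {k : Kind} {d ℓ : ℕ}

/-- The identification of matrices with operators. -/
noncomputable abbrev toCLM : FullOp k d ℓ ≃⋆ₐ[ℂ] (Hilb k d ℓ →L[ℂ] Hilb k d ℓ) :=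
  Matrix.toEuclideanCLM (𝕜 := ℂ)

lemma norm_toCLM (A : FullOp k d ℓ) : ‖toCLM A‖ = ‖A‖ := Matrix.l2_opNorm_toEuclideanCLM A

lemma isSelfAdjoint_toCLM {A : FullOp k d ℓ} (hA : IsSelfAdjoint A) : IsSelfAdjoint (toCLM A) :=
  hA.map _

lemma mean_toCLM (ψ : Hilb k d ℓ) (A : FullOp k d ℓ) : mean ψ (toCLM A) = expect ψ A := rfl

/-- The observables of a region as operators. -/
noncomputable def localOps (k : Kind) {d ℓ : ℕ} (X : Finset (Torus d ℓ)) :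
    StarSubalgebra ℂ (Hilb k d ℓ →L[ℂ] Hilb k d ℓ) :=
  (localAlg k X).map (StarAlgHomClass.toStarAlgHom (toCLM : FullOp k d ℓ ≃⋆ₐ[ℂ] _))

lemma toCLM_mem_localOps {X : Finset (Torus d ℓ)} {A : FullOp k d ℓ} (hA : A ∈ localAlg k X) :
    toCLM A ∈ localOps k X := ⟨A, hA, rfl⟩

lemma exists_of_mem_localOps {X : Finset (Torus d ℓ)} {B : Hilb k d ℓ →L[ℂ] Hilb k d ℓ}
    (hB : B ∈ localOps k X) : ∃ A ∈ localAlg k X, toCLM A = B := hB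

lemma isClosed_localOps (X : Finset (Torus d ℓ)) :
    IsClosed (localOps k X : Set (Hilb k d ℓ →L[ℂ] Hilb k d ℓ)) :=
  (localOps k X).toSubalgebra.toSubmodule.closed_of_finiteDimensional

end Torus

/-! ### The estimate on a finite torus -/

section Charges

variable {k : Kind} {d ℓ : ℕ} {q : Torus d ℓ → FullOp k d ℓ}

lemma commute_charges (hq : ∀ x, q x ∈ localAlg k {x}) (x y : Torus d ℓ) :
    Commute (q x) (q y) := by
  by_cases h : x = y
  · rw [h]
  · exact localAlg_commute k (Finset.disjoint_singleton.2 h) (hq x) (hq y)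

lemma sum_charges_mem (hq : ∀ x, q x ∈ localAlg k {x}) (X : Finset (Torus d ℓ)) :
    ∑ x ∈ X, q x ∈ localAlg k X :=
  sum_mem fun x hx => localAlg_mono k (Finset.singleton_subset_iff.2 hx) (hq x)

lemma expI_sum_charges (hq : ∀ x, q x ∈ localAlg k {x}) (hsa : ∀ x, IsSelfAdjoint (q x))
    (hs : ∀ x, spectrum ℂ (q x) ⊆ Set.range (fun m : ℤ => (m : ℂ))) (X : Finset (Torus d ℓ)) :
    expI (toCLM (∑ x ∈ X, q x)) (2 * Real.pi) = 1 := by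
  rw [map_sum]
  refine expI_sum_eq_one X (fun x y => (commute_charges hq x y).map toCLM) fun x =>
    expI_two_pi_of_spectrum (isSelfAdjoint_toCLM (hsa x)) ?_
  rw [AlgEquiv.spectrum_eq (toCLM : FullOp k d ℓ ≃⋆ₐ[ℂ] _)]
  exact hs x

lemma isSelfAdjoint_sum_charges (hsa : ∀ x, IsSelfAdjoint (q x)) (X : Finset (Torus d ℓ)) :
    IsSelfAdjoint (∑ x ∈ X, q x) := isSelfAdjoint_sum X fun x _ => hsa x

end Charges

/-- A local approximation of a self-adjoint operator can be chosen self-adjoint. -/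
lemma exists_isSelfAdjoint_approx {k : Kind} {d ℓ : ℕ} {X : Finset (Torus d ℓ)}
    {A R : FullOp k d ℓ} (hA : IsSelfAdjoint A) (hR : R ∈ localAlg k X) {δ : ℝ}
    (h : ‖A - R‖ ≤ δ) :
    ∃ R' ∈ localAlg k X, IsSelfAdjoint R' ∧ ‖A - R'‖ ≤ δ := by
  refine ⟨(2⁻¹ : ℂ) • (R + star R), (localAlg k X).smul_mem (add_mem hR (star_mem hR)) _, ?_, ?_⟩
  · simp [IsSelfAdjoint, star_smul, add_comm]
  · have h1 : A - (2⁻¹ : ℂ) • (R + star R) = (2⁻¹ : ℂ) • ((A - R) + star (A - R)) := by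
      rw [star_sub, hA.star_eq]
      module
    rw [h1, norm_smul]
    have h2 := norm_add_le (A - R) (star (A - R))
    rw [norm_star] at h2
    have h3 : ‖(2⁻¹ : ℂ)‖ = 2⁻¹ := by simp
    rw [h3]
    linarith

/-- The finite-volume form of the theorem: with all errors bounded by `ε`, the expectation of `T₋`
is an integer up to `(N + 1) √ε`. -/
theorem norm_exp_expect_sub_one_le {k : Kind} {d ℓ : ℕ} [NeZero d] (hℓ : 16 ≤ ℓ)
    {q : Torus d ℓ → FullOp k d ℓ} (hq : ∀ x, q x ∈ localAlg k {x})
    (hqsa : ∀ x, IsSelfAdjoint (q x))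
    (hqs : ∀ x, spectrum ℂ (q x) ⊆ Set.range (fun m : ℤ => (m : ℂ)))
    {Q U Tm Tp Km Kp Rm Rp : FullOp k d ℓ} (hQ : Q = ∑ x ∈ halfTorus d ℓ, q x)
    {Ω : Hilb k d ℓ} (hΩ : ‖Ω‖ = 1) (hU : U ∈ unitary (FullOp k d ℓ))
    (sTm : IsSelfAdjoint Tm) (sTp : IsSelfAdjoint Tp) (sKm : IsSelfAdjoint Km)
    (sKp : IsSelfAdjoint Kp)
    (mTm : Tm ∈ localAlg k (stripMinus d ℓ)) (mTp : Tp ∈ localAlg k (stripPlus d ℓ))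
    (mKm : Km ∈ localAlg k (stripMinus d ℓ)) (mKp : Kp ∈ localAlg k (stripPlus d ℓ))
    (mRm : Rm ∈ localAlg k (stripMinus d ℓ)) (mRp : Rp ∈ localAlg k (stripPlus d ℓ))
    {N ε : ℝ} (hε : ε ≤ 1) (hTm : ‖Tm‖ ≤ N) (hKm : ‖Km‖ + 1 ≤ N)
    (htrans : ‖star U * Q * U - Q - Tm - Tp‖ ≤ ε)
    (hinv : ‖act U Ω - expect Ω U • Ω‖ ≤ ε)
    (hfluct : ‖act (Q - Km - Kp) Ω - expect Ω (Q - Km - Kp) • Ω‖ ≤ ε)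
    (hsplit : ‖NormedSpace.exp ((2 * Real.pi * Complex.I : ℂ) • (Q + Tm)) - 1‖ ≤ ε)
    (hRm : ‖star U * Km * U - Rm‖ ≤ ε) (hRp : ‖star U * Kp * U - Rp‖ ≤ ε)
    (hcl : ∀ A ∈ localAlg k (stripMinus d ℓ), ∀ B ∈ localAlg k (stripPlus d ℓ),
      ‖expect Ω (A * B) - expect Ω A * expect Ω B‖ ≤ ε * (‖A‖ * ‖B‖)) :
    ‖Complex.exp (2 * Real.pi * Complex.I * expect Ω Tm) - 1‖ ≤ 851 * ((N + 1) * √ε) := by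
  have hdisj := disjoint_strips (d := d) (ℓ := ℓ) (by omega)
  have sconj : ∀ {K : FullOp k d ℓ}, IsSelfAdjoint K → IsSelfAdjoint (star U * K * U) :=
    fun {K} hK => by simp [IsSelfAdjoint, hK.star_eq, mul_assoc]
  obtain ⟨Rm', mRm', sRm', hRm'⟩ := exists_isSelfAdjoint_approx (sconj sKm) mRm hRm
  obtain ⟨Rp', mRp', sRp', hRp'⟩ := exists_isSelfAdjoint_approx (sconj sKp) mRp hRp
  set Γ := halfTorus d ℓ
  set Γm := Γ ∩ stripMinus d ℓ with hΓm
  set Γp := Γ ∩ stripPlus d ℓ with hΓp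
  set Γ₀ := Γ \ (stripMinus d ℓ ∪ stripPlus d ℓ) with hΓ₀
  have hsum : Q = ∑ x ∈ Γ₀, q x + ∑ x ∈ Γm, q x + ∑ x ∈ Γp, q x := by
    have h1 : Disjoint Γm Γp :=
      hdisj.mono Finset.inter_subset_right Finset.inter_subset_right
    rw [add_assoc, ← Finset.sum_union h1, hΓm, hΓp, ← Finset.inter_union_distrib_left, hQ, hΓ₀,
      add_comm, ← Finset.sum_inter_add_sum_sdiff]
  have hd₀ : ∀ {X}, X ⊆ stripMinus d ℓ ∪ stripPlus d ℓ → Disjoint Γ₀ X := fun hX =>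
    Finset.sdiff_disjoint.mono_right hX
  have toQ : toCLM (∑ x ∈ Γ₀, q x) + toCLM (∑ x ∈ Γm, q x) + toCLM (∑ x ∈ Γp, q x) = toCLM Q := by
    rw [hsum, map_add, map_add]
  have sQ : IsSelfAdjoint Q := by rw [hQ]; exact isSelfAdjoint_sum_charges hqsa _
  have hnorm : ∀ A : FullOp k d ℓ, ‖toCLM A‖ = ‖A‖ := norm_toCLM
  let S : SplitModel (Hilb k d ℓ) :=
    { Ω := Ω
      norm_Ω := hΩ
      M := localOps k (stripMinus d ℓ)
      P := localOps k (stripPlus d ℓ)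
      isClosed_M := isClosed_localOps _
      isClosed_P := isClosed_localOps _
      comm := by
        intro A hA B hB
        obtain ⟨A, hA', rfl⟩ := exists_of_mem_localOps hA
        obtain ⟨B, hB', rfl⟩ := exists_of_mem_localOps hB
        exact (localAlg_commute k hdisj hA' hB').map toCLM
      U := toCLM U
      U_mem := Unitary.map_mem _ hU
      Q₀ := toCLM (∑ x ∈ Γ₀, q x)
      Qm := toCLM (∑ x ∈ Γm, q x)
      Qp := toCLM (∑ x ∈ Γp, q x)
      Tm := toCLM Tm
      Tp := toCLM Tp
      Km := toCLM Km
      Kp := toCLM Kp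
      Rm := toCLM Rm'
      Rp := toCLM Rp'
      sa_Q₀ := isSelfAdjoint_toCLM (isSelfAdjoint_sum_charges hqsa _)
      sa_Qm := isSelfAdjoint_toCLM (isSelfAdjoint_sum_charges hqsa _)
      sa_Qp := isSelfAdjoint_toCLM (isSelfAdjoint_sum_charges hqsa _)
      sa_Tm := isSelfAdjoint_toCLM sTm
      sa_Tp := isSelfAdjoint_toCLM sTp
      sa_Km := isSelfAdjoint_toCLM sKm
      sa_Kp := isSelfAdjoint_toCLM sKp
      sa_Rm := isSelfAdjoint_toCLM sRm'
      sa_Rp := isSelfAdjoint_toCLM sRp'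
      Qm_mem := toCLM_mem_localOps
        (localAlg_mono k Finset.inter_subset_right (sum_charges_mem hq _))
      Tm_mem := toCLM_mem_localOps mTm
      Km_mem := toCLM_mem_localOps mKm
      Rm_mem := toCLM_mem_localOps mRm'
      Qp_mem := toCLM_mem_localOps
        (localAlg_mono k Finset.inter_subset_right (sum_charges_mem hq _))
      Tp_mem := toCLM_mem_localOps mTp
      Kp_mem := toCLM_mem_localOps mKp
      Rp_mem := toCLM_mem_localOps mRp'
      comm_M := by
        intro A hA
        obtain ⟨A, hA', rfl⟩ := exists_of_mem_localOps hA
        exact (localAlg_commute k (hd₀ Finset.subset_union_left) (sum_charges_mem hq _) hA').map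
          toCLM
      comm_P := by
        intro A hA
        obtain ⟨A, hA', rfl⟩ := exists_of_mem_localOps hA
        exact (localAlg_commute k (hd₀ Finset.subset_union_right) (sum_charges_mem hq _) hA').map
          toCLM
      exp_Q₀ := expI_sum_charges hq hqsa hqs _
      exp_Qm := expI_sum_charges hq hqsa hqs _
      exp_Qp := expI_sum_charges hq hqsa hqs _
      κ := (expect Ω (Q - Km - Kp)).re
      N := N
      ε := ε
      ε_le_one := hε
      transport := by
        rw [toQ, ← map_star, ← map_mul, ← map_mul, ← map_sub, ← map_sub, ← map_sub, hnorm]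
        exact htrans
      invariant := hinv
      fluctuation := by
        have h1 : ((expect Ω (Q - Km - Kp)).re : ℂ) = expect Ω (Q - Km - Kp) := by
          rw [← Complex.conj_eq_iff_re, ← mean_toCLM, ← mean_star,
            (isSelfAdjoint_toCLM ((sQ.sub sKm).sub sKp)).star_eq]
        rw [h1, toQ, ← map_sub, ← map_sub]
        exact hfluct
      splitting := by
        rw [toQ, ← map_add, expI, smul_smul, ← map_smul]
        let +nondep : NormedAlgebra ℚ (FullOp k d ℓ) := .restrictScalars ℚ ℂ _
        have h1 : Continuous (toCLM : FullOp k d ℓ ≃⋆ₐ[ℂ] _) :=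
          (AddMonoidHomClass.isometry_of_norm (toCLM : FullOp k d ℓ ≃⋆ₐ[ℂ] _) hnorm).continuous
        rw [← NormedSpace.map_exp (toCLM : FullOp k d ℓ ≃⋆ₐ[ℂ] _) h1,
          ← map_one (toCLM : FullOp k d ℓ ≃⋆ₐ[ℂ] _), ← map_sub, hnorm]
        simpa using hsplit
      approx_Km := by
        rw [← map_star, ← map_mul, ← map_mul, ← map_sub, hnorm]
        exact hRm'
      approx_Kp := by
        rw [← map_star, ← map_mul, ← map_mul, ← map_sub, hnorm]
        exact hRp'
      cluster := by
        intro A hA B hB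
        obtain ⟨A, hA', rfl⟩ := exists_of_mem_localOps hA
        obtain ⟨B, hB', rfl⟩ := exists_of_mem_localOps hB
        rw [← map_mul, mean_toCLM, mean_toCLM, mean_toCLM, hnorm, hnorm]
        exact hcl A hA' B hB'
      norm_Tm := by rw [hnorm]; exact hTm
      norm_Km := by rw [hnorm]; linarith
      norm_Rm := by
        rw [hnorm]
        have h1 : ‖star U * Km * U‖ = ‖Km‖ := by
          rw [CStarRing.norm_mul_mem_unitary _ hU,
            CStarRing.norm_mem_unitary_mul _ (Unitary.star_mem hU)]
        have h2 := norm_sub_norm_le Rm' (star U * Km * U)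
        rw [norm_sub_rev] at h2
        linarith }
  exact S.norm_exp_mean_Tm_sub_one_le

/-! ### The thermodynamic limit -/

/-- Evaluation is jointly sequentially continuous for the weak-* and the norm topology, by the
uniform boundedness principle. -/
lemma tendsto_apply_of_tendsto_weakDual {E : Type*} [NormedAddCommGroup E] [NormedSpace ℂ E]
    [CompleteSpace E] {ω : ℕ → WeakDual ℂ E} {ω' : WeakDual ℂ E} (hω : Tendsto ω atTop (𝓝 ω'))
    {x : ℕ → E} {x' : E} (hx : Tendsto x atTop (𝓝 x')) :
    Tendsto (fun i => ω i (x i)) atTop (𝓝 (ω' x')) := by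
  have hp : ∀ y, Tendsto (fun i => ω i y) atTop (𝓝 (ω' y)) := fun y =>
    ((WeakDual.eval_continuous y).tendsto ω').comp hω
  obtain ⟨C, hC⟩ := banach_steinhaus (g := fun i => WeakDual.toStrongDual (ω i)) fun y => by
    obtain ⟨C, hC⟩ := (hp y).norm.bddAbove_range
    exact ⟨C, fun i => hC ⟨i, rfl⟩⟩
  have h1 : Tendsto (fun i => ω i (x i - x')) atTop (𝓝 0) := by
    have h2 : Tendsto (fun i => C * ‖x i - x'‖) atTop (𝓝 0) := by
      simpa using (tendsto_iff_norm_sub_tendsto_zero.1 hx).const_mul C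
    refine squeeze_zero_norm (fun i => ?_) h2
    exact ((WeakDual.toStrongDual (ω i)).le_opNorm _).trans
      (mul_le_mul_of_nonneg_right (hC i) (norm_nonneg _))
  simpa using h1.add (hp x')

lemma exists_int_tendsto {z : ℕ → ℂ} {z' : ℂ} (hz : Tendsto z atTop (𝓝 z'))
    (h : Tendsto (fun i => ‖Complex.exp (2 * Real.pi * Complex.I * z i) - 1‖) atTop (𝓝 0)) :
    ∃ m : ℤ, Tendsto z atTop (𝓝 (m : ℂ)) := by
  have h1 : Tendsto (fun i => Complex.exp (2 * Real.pi * Complex.I * z i)) atTop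
      (𝓝 (Complex.exp (2 * Real.pi * Complex.I * z'))) :=
    (Complex.continuous_exp.tendsto _).comp (hz.const_mul _)
  have h2 := tendsto_nhds_unique h1 (tendsto_iff_norm_sub_tendsto_zero.2 h)
  obtain ⟨m, hm⟩ := Complex.exp_eq_one_iff.1 h2
  refine ⟨m, ?_⟩
  have h3 : z' = m := by
    have h4 : (2 * Real.pi * Complex.I : ℂ) ≠ 0 := Complex.two_pi_I_ne_zero
    exact mul_left_cancel₀ h4 (by rw [hm, mul_comm])
  rwa [← h3]

lemma superpolynomialDecay_mul_card {f : ℕ → ℝ}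
    (hf : Asymptotics.SuperpolynomialDecay atTop (fun N : ℕ => (N : ℝ)) f) (d : ℕ) :
    Asymptotics.SuperpolynomialDecay atTop (fun N : ℕ => (N : ℝ))
      fun N => f N * (Fintype.card (Torus d N) : ℝ) := by
  refine ((hf.mul_param_pow d).mul_const (2 ^ d)).congr fun N => ?_
  simp only [Pi.mul_apply, Pi.pow_apply, card_torus]
  push_cast
  ring

lemma superpolynomialDecay_abs {f : ℕ → ℝ}
    (hf : Asymptotics.SuperpolynomialDecay atTop (fun N : ℕ => (N : ℝ)) f) :
    Asymptotics.SuperpolynomialDecay atTop (fun N : ℕ => (N : ℝ)) fun N => |f N| :=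
  hf.trans_abs_le fun N => (abs_abs (f N)).le

lemma cluster_error_le {C a b x y v e e' : ℝ} (hC : 0 ≤ C) (ha : 0 ≤ a) (hb : 0 ≤ b)
    (hy0 : 0 ≤ y) (hx : x ≤ v) (hy : y ≤ v) (hv : 0 ≤ v) (he0 : 0 ≤ e) (he : e ≤ e') :
    C * a * b * x * y * e ≤ C * e' * v * v * (a * b) :=
  calc C * a * b * x * y * e ≤ C * a * b * v * v * e' := by gcongr
    _ = C * e' * v * v * (a * b) := by ring

end ManyBodyIndex

theorem mainTheorem8 {d : ℕ} [NeZero d] (k : Kind)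
    (q : ∀ ℓ, Torus d ℓ → FullOp k d ℓ) (hq : IsCharge q)
    (U Tm Tp : ∀ ℓ, Obs k d ℓ)
    (Ω : ∀ ℓ, Hilb k d ℓ) (hΩ : ∀ ℓ, ‖Ω ℓ‖ = 1)
    (hU : IsAlmostLocalUnitary U)
    (hT : LocalChargeConservation q U Tm Tp)
    (hinv : RapidDecay fun ℓ => variance (Ω ℓ) (U ℓ : FullOp k d ℓ))
    (hK : LocalChargeFluctuations q Ω)
    (hclust : IsClustering Ω)
    (hconstr : SplittingConstraint q Tm Tp)
    (ω : ℕ → WeakDual ℂ (QuasiLocal k d))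
    (hω : ∀ ℓ, IsState (ω ℓ) ∧
      ∀ A : Obs k d ℓ, ω ℓ (toQuasiLocal A) = expect (Ω ℓ) (A : FullOp k d ℓ))
    (hωlim : ∃ ω' : WeakDual ℂ (QuasiLocal k d), Tendsto ω atTop (𝓝 ω'))
    (hTlim : ∃ T' : QuasiLocal k d, Tendsto (fun ℓ => toQuasiLocal (Tm ℓ)) atTop (𝓝 T')) :
    ∃ m : ℤ, Tendsto (fun ℓ => expect (Ω ℓ) (Tm ℓ : FullOp k d ℓ)) atTop (𝓝 (m : ℂ)) := by
  obtain ⟨hU1, g, hg, hgb⟩ := hU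
  obtain ⟨hTm, hTp, htr⟩ := hT
  obtain ⟨Km, Kp, hKm, hKp, ⟨C₁, hC₁⟩, hfl⟩ := hK
  obtain ⟨c, C₂, hc, hC₂, hcl⟩ := hclust
  obtain ⟨hsp, C₃, hC₃⟩ := hconstr
  obtain ⟨ω', hω'⟩ := hωlim
  obtain ⟨T', hT'⟩ := hTlim
  have hlim := tendsto_apply_of_tendsto_weakDual hω' hT'
  simp only [(hω _).2] at hlim
  refine exists_int_tendsto hlim ?_
  have hV0 : ∀ ℓ, (0 : ℝ) ≤ Fintype.card (Torus d ℓ) := fun ℓ => Nat.cast_nonneg _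
  obtain ⟨C, hC⟩ : ∃ C, C = |C₁| + |C₃| := ⟨_, rfl⟩
  have hC0 : 0 ≤ C := by rw [hC]; positivity
  -- the errors are kept opaque, and their sum is the common bound `ε`
  obtain ⟨f₁, e₁⟩ : ∃ f : ℕ → ℝ, f = fun ℓ => ‖star (U ℓ : FullOp k d ℓ) * halfCharge q ℓ *
    (U ℓ : FullOp k d ℓ) - halfCharge q ℓ - (Tm ℓ : FullOp k d ℓ) - (Tp ℓ : FullOp k d ℓ)‖ :=
    ⟨_, rfl⟩
  obtain ⟨f₂, e₂⟩ : ∃ f : ℕ → ℝ, f = fun ℓ => √(variance (Ω ℓ) (U ℓ : FullOp k d ℓ)) := ⟨_, rfl⟩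
  obtain ⟨f₃, e₃⟩ : ∃ f : ℕ → ℝ, f = fun ℓ => √(variance (Ω ℓ) (halfCharge q ℓ - Km ℓ - Kp ℓ)) :=
    ⟨_, rfl⟩
  obtain ⟨f₄, e₄⟩ : ∃ f : ℕ → ℝ, f = fun ℓ => ‖NormedSpace.exp ((2 * Real.pi * Complex.I : ℂ) •
    (halfCharge q ℓ + (Tm ℓ : FullOp k d ℓ))) - 1‖ := ⟨_, rfl⟩
  obtain ⟨f₅, e₅⟩ : ∃ f : ℕ → ℝ, f = fun ℓ => C * |g (ℓ / 16)| * Fintype.card (Torus d ℓ) *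
    Fintype.card (Torus d ℓ) := ⟨_, rfl⟩
  obtain ⟨f₆, e₆⟩ : ∃ f : ℕ → ℝ, f = fun ℓ : ℕ => C₂ * Real.exp (-(c / 2) * ℓ) *
    Fintype.card (Torus d ℓ) * Fintype.card (Torus d ℓ) := ⟨_, rfl⟩
  have s₁ := htr.superpolynomialDecay
  have s₂ := superpolynomialDecay_sqrt hinv.superpolynomialDecay
  have s₃ := superpolynomialDecay_sqrt hfl.superpolynomialDecay
  have s₄ := hsp.superpolynomialDecay
  have s₅ := superpolynomialDecay_mul_card (superpolynomialDecay_mul_card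
    ((superpolynomialDecay_abs (superpolynomialDecay_comp_div hg.superpolynomialDecay
      (b := 16) (by norm_num))).const_mul C) d) d
  have s₆ := superpolynomialDecay_mul_card (superpolynomialDecay_mul_card
    ((superpolynomialDecay_exp_neg (half_pos hc)).const_mul C₂) d) d
  rw [← e₁] at s₁
  rw [← e₂] at s₂
  rw [← e₃] at s₃
  rw [← e₄] at s₄
  rw [← e₅] at s₅
  rw [← e₆] at s₆
  obtain ⟨ε, hε⟩ : ∃ ε, ε = f₁ + f₂ + f₃ + f₄ + f₅ + f₆ := ⟨_, rfl⟩
  have sε := ((((s₁.add s₂).add s₃).add s₄).add s₅).add s₆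
  rw [← hε] at sε
  have hε1 : ∀ᶠ ℓ in atTop, ε ℓ ≤ 1 := by
    have h := sε 0
    simp only [pow_zero, one_mul] at h
    exact h.eventually_le_const one_pos
  have hbound : Tendsto (fun ℓ => 851 * ((C * Fintype.card (Torus d ℓ) + 1 + 1) * √(ε ℓ))) atTop
      (𝓝 0) := by
    have h := superpolynomialDecay_sqrt sε
    have h1 := ((superpolynomialDecay_mul_card h d 0).const_mul (851 * C)).add
      ((h 0).const_mul (851 * 2))
    simp only [mul_zero, add_zero] at h1
    refine h1.congr fun ℓ => ?_
    ring
  refine squeeze_zero' (Eventually.of_forall fun _ => norm_nonneg _) ?_ hbound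
  filter_upwards [hε1, eventually_ge_atTop 16] with ℓ hℓ1 hℓ
  have hℓ' : 1 ≤ ℓ := by omega
  replace e₁ := congrFun e₁ ℓ
  replace e₂ := congrFun e₂ ℓ
  replace e₃ := congrFun e₃ ℓ
  replace e₄ := congrFun e₄ ℓ
  replace e₅ := congrFun e₅ ℓ
  replace e₆ := congrFun e₆ ℓ
  have hεℓ : ε ℓ = f₁ ℓ + f₂ ℓ + f₃ ℓ + f₄ ℓ + f₅ ℓ + f₆ ℓ := congrFun hε ℓ
  replace hV0 := hV0 ℓ
  replace hC₁ := hC₁ ℓ hℓ'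
  replace hC₃ := hC₃ ℓ hℓ'
  have hcard : ∀ X : Finset (Torus d ℓ), (X.card : ℝ) ≤ Fintype.card (Torus d ℓ) := fun X =>
    Nat.cast_le.2 (Finset.card_le_univ X)
  generalize (Fintype.card (Torus d ℓ) : ℝ) = V at *
  have p₁ : 0 ≤ f₁ ℓ := by rw [e₁]; exact norm_nonneg _
  have p₂ : 0 ≤ f₂ ℓ := by rw [e₂]; exact Real.sqrt_nonneg _
  have p₃ : 0 ≤ f₃ ℓ := by rw [e₃]; exact Real.sqrt_nonneg _
  have p₄ : 0 ≤ f₄ ℓ := by rw [e₄]; exact norm_nonneg _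
  have p₅ : 0 ≤ f₅ ℓ := by rw [e₅]; positivity
  have p₆ : 0 ≤ f₆ ℓ := by rw [e₆]; positivity
  have hle₁ : C₁ * V ≤ C * V := mul_le_mul_of_nonneg_right
    (by rw [hC]; linarith only [le_abs_self C₁, abs_nonneg C₃]) hV0
  have hle₃ : C₃ * V ≤ C * V := mul_le_mul_of_nonneg_right
    (by rw [hC]; linarith only [le_abs_self C₃, abs_nonneg C₁]) hV0
  -- conjugation by `U` is truncated at range `ℓ / 16`, for which the fattened boundaries still fit
  -- in the strips
  have hR : ∀ (X : Finset (Torus d ℓ)) (K : FullOp k d ℓ), K ∈ localAlg k X → ‖K‖ ≤ C * V →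
      ∃ R ∈ localAlg k (fatten X ((ℓ / 16 : ℕ) : ℝ)),
        ‖star (U ℓ : FullOp k d ℓ) * K * (U ℓ : FullOp k d ℓ) - R‖ ≤ ε ℓ := by
    intro X K hKX hKn
    obtain ⟨R, hR, hRn⟩ := hgb ℓ X K hKX (ℓ / 16)
    refine ⟨R, hR, hRn.trans ?_⟩
    have h1 : ‖K‖ * X.card ≤ C * V * V :=
      mul_le_mul hKn (hcard X) (Nat.cast_nonneg _) ((norm_nonneg _).trans hKn)
    have h2 : 0 ≤ ‖K‖ * X.card := mul_nonneg (norm_nonneg _) (Nat.cast_nonneg _)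
    calc g (ℓ / 16) * (‖K‖ * X.card) ≤ |g (ℓ / 16)| * (‖K‖ * X.card) :=
          mul_le_mul_of_nonneg_right (le_abs_self _) h2
      _ ≤ |g (ℓ / 16)| * (C * V * V) := mul_le_mul_of_nonneg_left h1 (abs_nonneg _)
      _ = f₅ ℓ := by rw [e₅]; ring
      _ ≤ ε ℓ := by linarith only [hεℓ, p₁, p₂, p₃, p₄, p₅, p₆]
  have nKm := hC₁.1.trans hle₁
  have nKp := hC₁.2.trans hle₁
  obtain ⟨Rm, mRm, hRm⟩ := hR _ _ (hKm ℓ).2 nKm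
  obtain ⟨Rp, mRp, hRp⟩ := hR _ _ (hKp ℓ).2 nKp
  have hsubm := fatten_fatten_bdryMinus_subset (d := d) (ℓ := ℓ)
  have hsubp := fatten_fatten_bdryPlus_subset (d := d) hℓ
  refine norm_exp_expect_sub_one_le hℓ (fun x => (hq ℓ x).1) (fun x => (hq ℓ x).2.1)
    (fun x => (hq ℓ x).2.2) (Q := halfCharge q ℓ) (U := U ℓ) (Tm := Tm ℓ) (Tp := Tp ℓ)
    (Km := Km ℓ) (Kp := Kp ℓ) rfl (hΩ ℓ) (hU1 ℓ) ((hTm ℓ).1.map (StarSubalgebra.subtype _))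
    ((hTp ℓ).1.map (StarSubalgebra.subtype _)) (hKm ℓ).1 (hKp ℓ).1 (hTm ℓ).2 (hTp ℓ).2
    (localAlg_mono k ((subset_fatten _ (Nat.cast_nonneg _)).trans hsubm) (hKm ℓ).2)
    (localAlg_mono k ((subset_fatten _ (Nat.cast_nonneg _)).trans hsubp) (hKp ℓ).2)
    (localAlg_mono k hsubm mRm) (localAlg_mono k hsubp mRp) hℓ1 ?_ ?_ ?_ ?_ ?_ ?_ hRm hRp ?_
  · have := hC₃.1.trans hle₃
    exact this.trans (le_add_of_nonneg_right zero_le_one)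
  · exact add_le_add_left nKm 1
  · rw [← e₁]
    linarith only [hεℓ, p₁, p₂, p₃, p₄, p₅, p₆]
  · rw [variance, Real.sqrt_sq (norm_nonneg _)] at e₂
    rw [← e₂]
    linarith only [hεℓ, p₁, p₂, p₃, p₄, p₅, p₆]
  · rw [variance, Real.sqrt_sq (norm_nonneg _)] at e₃
    rw [← e₃]
    linarith only [hεℓ, p₁, p₂, p₃, p₄, p₅, p₆]
  · rw [← e₄]
    linarith only [hεℓ, p₁, p₂, p₃, p₄, p₅, p₆]
  · intro A hA B hB
    refine (hcl ℓ _ _ A hA B hB).trans ?_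
    have h1 : Real.exp (-c * dist₁ (stripMinus d ℓ) (stripPlus d ℓ)) ≤
        Real.exp (-(c / 2) * ℓ) := by
      rw [Real.exp_le_exp]
      have h2 : (ℓ : ℝ) ≤ 2 * dist₁ (stripMinus d ℓ) (stripPlus d ℓ) := by
        exact_mod_cast le_two_mul_dist₁_strips hℓ'
      nlinarith only [hc, h2]
    refine (cluster_error_le hC₂.le (norm_nonneg _) (norm_nonneg _) (Nat.cast_nonneg _)
      (hcard _) (hcard _) hV0 (Real.exp_nonneg _) h1).trans ?_
    rw [← e₆]
    refine mul_le_mul_of_nonneg_right ?_ (mul_nonneg (norm_nonneg _) (norm_nonneg _))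
    linarith only [hεℓ, p₁, p₂, p₃, p₄, p₅, p₆]
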